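/- Let $\Bbbk$ be a field of characteristic zero. Let $U(3)$ be the universal associative conformal envelope of the Virasoro Lie conformal algebra relative to the locality bound $N=3$: the associative conformal algebra generated by one element $v$ with defining relations $v\circ_{n} v=0$ for $n\ge 3$ and $2\,(v\circ_{1}v)-\partial(v\circ_{2}v)=2v$. For $\alpha,\Delta\in\Bbbk$ let $M_{(\alpha,\Delta)}=\Bbbk[\partial]u$ be the free $\Bbbk[\partial]$-module of rank one with the conformal action of $U(3)$ determined by $(v\circ_{\lambda}u)=(\alpha+\partial+\Delta\lambda)u$. For an associative conformal algebra $C$ and a left conformal $C$-module $M$, let $\tilde{\mathrm C}^n(C,M)$ be the space of multilinear maps $\varphi_{\lambda_1,\dots,\lambda_n}:C^{\otimes n}\to M[\lambda_1,\dots,\lambda_n]$ such that $\varphi_{\bar\lambda}(\dots,\partial a_i,\dots)=-\lambda_i\varphi_{\bar\lambda}(\dots,a_i,\dots)$ for all $i$ (so $\tilde{\mathrm C}^0(C,M)=M$), with the differential $$(d\varphi)_{\bar\lambda}(a_1,\dots,a_{n+1})=a_1\circ_{\lambda_1}\varphi_{\lambda_2,\dots,\lambda_{n+1}}(a_2,\dots,a_{n+1})+\sum_{i=1}^{n}(-1)^i\varphi_{\lambda_1,\dots,\lambda_i+\lambda_{i+1},\dots,\lambda_{n+1}}(a_1,\dots,a_i\circ_{\lambda_i}a_{i+1},\dots,a_{n+1})$$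 and the operator $(\partial\varphi)_{\bar\lambda}=(\partial+\lambda_1+\dots+\lambda_n)\varphi_{\bar\lambda}$, which commutes with $d$. Let $\mathrm H^n(C,M)$ be the $n$-th cohomology of the reduced Hochschild complex $\tilde{\mathrm C}^\bullet(C,M)/\partial\tilde{\mathrm C}^\bullet(C,M)$. Let $\Delta\neq 0$. Then $$\dim_{\Bbbk}\mathrm H^1(U(3),M_{(\alpha,\Delta)})=\begin{cases}2,&\Delta=1\text{ and }\alpha=0,\\0,&\text{otherwise.}\end{cases}$$ -/

import Mathlib

open Finset

/-- An associative conformal algebra over `k`, in terms of its `n`-products `(a ∘ₙ b) = prod n a b`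
and of the operator `∂ = der`.  The `λ`-product is `(a ∘_λ b) = ∑ₙ (λⁿ / n!) (a ∘ₙ b)`. -/
class AssocConformalAlgebra (k C : Type*) [Field k] [AddCommGroup C] [Module k C] where
  der : C →ₗ[k] C
  prod : ℕ → C →ₗ[k] C →ₗ[k] C
  locality : ∀ a b : C, ∃ N : ℕ, ∀ n, N ≤ n → prod n a b = 0
  der_prod : ∀ (n : ℕ) (a b : C), prod n (der a) b = -(n • prod (n - 1) a b)
  prod_der : ∀ (n : ℕ) (a b : C), prod n a (der b) = der (prod n a b) + n • prod (n - 1) a b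
  assoc : ∀ (n m : ℕ) (a b c : C), prod n a (prod m b c) =
    ∑ s ∈ range (n + 1), n.choose s • prod (m + s) (prod (n - s) a b) c

/-- A left conformal module `M` over an associative conformal algebra `C`: `act a n u = a(n)u` is the
coefficient of `λⁿ / n!` in `(a ∘_λ u)`, and `∂ = mder` on `M`. -/
class ConformalModule (k C M : Type*) [Field k] [AddCommGroup C] [Module k C]
    [AssocConformalAlgebra k C] [AddCommGroup M] [Module k M] where
  mder : M →ₗ[k] M
  act : ℕ → C →ₗ[k] M →ₗ[k] M
  locality : ∀ (a : C) (u : M), ∃ N : ℕ, ∀ n, N ≤ n → act n a u = 0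
  der_act : ∀ (n : ℕ) (a : C) (u : M),
    act n (AssocConformalAlgebra.der (k := k) a) u = -(n • act (n - 1) a u)
  act_mder : ∀ (n : ℕ) (a : C) (u : M),
    act n a (mder u) = mder (act n a u) + n • act (n - 1) a u
  act_act : ∀ (n m : ℕ) (a b : C) (u : M), act n a (act m b u) =
    ∑ s ∈ range (n + 1),
      n.choose s • act (m + s) (AssocConformalAlgebra.prod (k := k) (n - s) a b) u

/-! ### The reduced Hochschild complex -/

namespace ConformalCohomology

section
variable (k C M : Type*) [Field k] [AddCommGroup C] [Module k C] [AssocConformalAlgebra k C]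
  [AddCommGroup M] [Module k M] [ConformalModule k C M]

/-- Families `φ` of coefficients: `φ p a` stands for the coefficient of
`(λ₁ ^ p₁ / p₁!) ⋯ (λₙ ^ pₙ / pₙ!)` in `φ_{λ₁, …, λₙ}(a₁, …, aₙ)`. -/
abbrev Coeffs (_k C M : Type*) (n : ℕ) : Type _ := (Fin n → ℕ) → (Fin n → C) → M

/-- The space of basic Hochschild `n`-cochains: multilinear maps `C^{⊗ n} → M[λ₁, …, λₙ]` with
`φ_{λ}(…, ∂aᵢ, …) = -λᵢ φ_{λ}(…, aᵢ, …)`. In degree `0` this is `M`. -/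
def cochains (n : ℕ) : Submodule k (Coeffs k C M n) where
  carrier := {φ |
    (∀ p a i x y, φ p (Function.update a i (x + y)) =
        φ p (Function.update a i x) + φ p (Function.update a i y)) ∧
    (∀ p a i (c : k) x, φ p (Function.update a i (c • x)) = c • φ p (Function.update a i x)) ∧
    (∀ a, {p | φ p a ≠ 0}.Finite) ∧
    (∀ p a i, φ p (Function.update a i (AssocConformalAlgebra.der (k := k) (a i))) =
        -(p i • φ (Function.update p i (p i - 1)) a))}
  zero_mem' := by simp
  add_mem' := by
    rintro φ ψ ⟨h1, h2, h3, h4⟩ ⟨g1, g2, g3, g4⟩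
    refine ⟨?_, ?_, ?_, ?_⟩
    · intro p a i x y
      simp only [Pi.add_apply, h1, g1]
      abel
    · intro p a i c x
      simp only [Pi.add_apply, h2, g2, smul_add]
    · intro a
      refine ((h3 a).union (g3 a)).subset ?_
      intro p hp
      by_contra hc
      simp only [Set.mem_union, Set.mem_ofPred_eq, not_or, not_not] at hc
      exact hp (by simp [hc.1, hc.2])
    · intro p a i
      simp only [Pi.add_apply, h4, g4, smul_add]
      abel
  smul_mem' := by
    rintro c φ ⟨h1, h2, h3, h4⟩
    refine ⟨?_, ?_, ?_, ?_⟩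
    · intro p a i x y
      simp only [Pi.smul_apply, h1, smul_add]
    · intro p a i d x
      simp only [Pi.smul_apply, h2, smul_comm c d]
    · intro a
      refine (h3 a).subset ?_
      intro p hp hc
      exact hp (by simp [hc])
    · intro p a i
      simp only [Pi.smul_apply, h4, smul_neg, smul_comm c (p i)]

/-- The Hochschild differential (the right action of `C` on `M` is zero):
`(dφ)(a₁, …, aₙ₊₁) = a₁ ∘_{λ₁} φ_{λ₂, …}(a₂, …)
  + ∑ᵢ (-1)ⁱ φ_{…, λᵢ + λᵢ₊₁, …}(…, aᵢ ∘_{λᵢ} aᵢ₊₁, …)`.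
The coefficient of `(λ^p / p!) (μ^q / q!)` in `φ_{λ + μ}(a ∘_λ b)` is
`∑ₛ (p choose s) φ_{p + q - s}(a ∘ₛ b)`. -/
def d (n : ℕ) : Coeffs k C M n →ₗ[k] Coeffs k C M (n + 1) where
  toFun φ p a :=
    ConformalModule.act (k := k) (p 0) (a 0) (φ (Fin.tail p) (Fin.tail a)) +
    ∑ i : Fin n, (-1 : ℤ) ^ ((i : ℕ) + 1) •
      ∑ s ∈ range (p i.castSucc + 1), (p i.castSucc).choose s •
        φ (Fin.contractNth i.castSucc (fun x y => x + y - s) p)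
          (Fin.contractNth i.castSucc (fun x y => AssocConformalAlgebra.prod (k := k) s x y) a)
  map_add' φ ψ := by
    funext p a
    simp only [Pi.add_apply, map_add, smul_add, sum_add_distrib]
    abel
  map_smul' c φ := by
    funext p a
    simp only [Pi.smul_apply, map_smul, RingHom.id_apply, smul_add, smul_sum]
    congr 1
    refine sum_congr rfl fun i _ => sum_congr rfl fun s _ => ?_
    rw [smul_comm _ c, smul_comm _ c]

/-- The action of `∂` on cochains: multiplication by `∂ + λ₁ + ⋯ + λₙ`. -/
def partialOp (n : ℕ) : Coeffs k C M n →ₗ[k] Coeffs k C M n where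
  toFun φ p a := ConformalModule.mder (k := k) (C := C) (φ p a) +
    ∑ i : Fin n, p i • φ (Function.update p i (p i - 1)) a
  map_add' φ ψ := by
    funext p a
    simp only [Pi.add_apply, map_add, smul_add, sum_add_distrib]
    abel
  map_smul' c φ := by
    funext p a
    simp only [Pi.smul_apply, map_smul, RingHom.id_apply, smul_add, smul_sum]
    congr 1
    refine sum_congr rfl fun i _ => ?_
    rw [smul_comm]

/-- Basic cochains which represent cocycles of the reduced complex: `dφ ∈ ∂ C̃ⁿ⁺¹`. -/
def reducedCocycles (n : ℕ) : Submodule k (Coeffs k C M n) :=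
  cochains k C M n ⊓
    ((cochains k C M (n + 1)).map (partialOp k C M (n + 1))).comap (d k C M n)

/-- Basic cochains which represent coboundaries of the reduced complex:
`d C̃ⁿ⁻¹ + ∂ C̃ⁿ` (with `C̃⁻¹ = 0`). -/
def reducedCoboundaries : (n : ℕ) → Submodule k (Coeffs k C M n)
  | 0 => (cochains k C M 0).map (partialOp k C M 0)
  | n + 1 => (cochains k C M n).map (d k C M n) ⊔
      (cochains k C M (n + 1)).map (partialOp k C M (n + 1))

/-- The `n`-th cohomology space `Hⁿ(C, M)` of the reduced Hochschild complex `C̃ / ∂ C̃`. -/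
abbrev H (n : ℕ) : Type _ :=
  reducedCocycles k C M n ⧸ (reducedCoboundaries k C M n).submoduleOf (reducedCocycles k C M n)

end

end ConformalCohomology

/-! ### The universal associative conformal envelope `U(3)` of the Virasoro conformal algebra -/

namespace VirasoroU3

/-- Words in one generator `v`, a unary operation `∂` and binary operations `∘ₙ`. -/
inductive Word : Type
  | v : Word
  | der : Word → Word
  | prod : ℕ → Word → Word → Word

section
variable (k : Type*) [Field k]

/-- The free `k`-module on words: the free algebra with operations `∂` and `∘ₙ`. -/
abbrev Free : Type _ := Word →₀ k

/-- The generator. -/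
noncomputable def Free.v : Free k := Finsupp.single Word.v 1

/-- The operation `∂`. -/
noncomputable def Free.der : Free k →ₗ[k] Free k :=
  Finsupp.linearCombination k fun w => Finsupp.single (Word.der w) 1

/-- The operations `∘ₙ`. -/
noncomputable def Free.prod (n : ℕ) : Free k →ₗ[k] Free k →ₗ[k] Free k :=
  Finsupp.linearCombination k fun w =>
    Finsupp.linearCombination k fun w' => Finsupp.single (Word.prod n w w') (1 : k)

/-- `S` is an ideal modulo which the identities of associative conformal algebras hold,
`v ∘ₙ v = 0` for `n ≥ 3`, and `2 (v ∘₁ v) - ∂ (v ∘₂ v) = 2 v`. -/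
structure IsRelIdeal (S : Submodule k (Free k)) : Prop where
  der_mem : ∀ a ∈ S, Free.der k a ∈ S
  prod_mem_left : ∀ n, ∀ a ∈ S, ∀ b, Free.prod k n a b ∈ S
  prod_mem_right : ∀ n a, ∀ b ∈ S, Free.prod k n a b ∈ S
  der_prod : ∀ (n : ℕ) (a b : Free k),
    Free.prod k n (Free.der k a) b + n • Free.prod k (n - 1) a b ∈ S
  prod_der : ∀ (n : ℕ) (a b : Free k), Free.prod k n a (Free.der k b) -
    (Free.der k (Free.prod k n a b) + n • Free.prod k (n - 1) a b) ∈ S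
  assoc : ∀ (n m : ℕ) (a b c : Free k), Free.prod k n a (Free.prod k m b c) -
    ∑ s ∈ range (n + 1), n.choose s • Free.prod k (m + s) (Free.prod k (n - s) a b) c ∈ S
  loc : ∀ n, 3 ≤ n → Free.prod k n (Free.v k) (Free.v k) ∈ S
  comm : 2 • Free.prod k 1 (Free.v k) (Free.v k) -
    Free.der k (Free.prod k 2 (Free.v k) (Free.v k)) - 2 • Free.v k ∈ S

/-- The smallest such ideal. -/
noncomputable def relIdeal : Submodule k (Free k) := sInf {S | IsRelIdeal k S}

theorem isRelIdeal_relIdeal : IsRelIdeal k (relIdeal k) where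
  der_mem a ha := by
    rw [relIdeal, Submodule.mem_sInf] at *
    exact fun S hS => hS.der_mem a (ha S hS)
  prod_mem_left n a ha b := by
    rw [relIdeal, Submodule.mem_sInf] at *
    exact fun S hS => hS.prod_mem_left n a (ha S hS) b
  prod_mem_right n a b hb := by
    rw [relIdeal, Submodule.mem_sInf] at *
    exact fun S hS => hS.prod_mem_right n a b (hb S hS)
  der_prod n a b := by
    rw [relIdeal, Submodule.mem_sInf]
    exact fun S hS => hS.der_prod n a b
  prod_der n a b := by
    rw [relIdeal, Submodule.mem_sInf]
    exact fun S hS => hS.prod_der n a b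
  assoc n m a b c := by
    rw [relIdeal, Submodule.mem_sInf]
    exact fun S hS => hS.assoc n m a b c
  loc n hn := by
    rw [relIdeal, Submodule.mem_sInf]
    exact fun S hS => hS.loc n hn
  comm := by
    rw [relIdeal, Submodule.mem_sInf]
    exact fun S hS => hS.comm

/-- The associative conformal algebra `U(3)`: generated by `v` subject to `v ∘ₙ v = 0` for `n ≥ 3`
and `2 (v ∘₁ v) - ∂ (v ∘₂ v) = 2 v`. -/
abbrev U3 : Type _ := Free k ⧸ relIdeal k

/-- The generator of `U(3)`. -/
noncomputable def U3.v : U3 k := (relIdeal k).mkQ (Free.v k)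

/-- The operation `∂` on `U(3)`. -/
noncomputable def U3.der : U3 k →ₗ[k] U3 k :=
  (relIdeal k).mapQ (relIdeal k) (Free.der k) fun a ha => (isRelIdeal_relIdeal k).der_mem a ha

/-- The operations `∘ₙ` on `U(3)`. -/
noncomputable def U3.prod (n : ℕ) : U3 k →ₗ[k] U3 k →ₗ[k] U3 k :=
  (relIdeal k).liftQ
    { toFun := fun a => (relIdeal k).mapQ (relIdeal k) (Free.prod k n a)
        fun b hb => (isRelIdeal_relIdeal k).prod_mem_right n a b hb
      map_add' := fun a b => by
        ext x
        simp
      map_smul' := fun c a => by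
        ext x
        simp }
    (fun a ha => by
      rw [LinearMap.mem_ker]
      refine LinearMap.ext fun x => ?_
      obtain ⟨b, rfl⟩ := (relIdeal k).mkQ_surjective x
      exact (Submodule.Quotient.mk_eq_zero _).2 ((isRelIdeal_relIdeal k).prod_mem_left n a ha b))

theorem U3.der_mk (a : Free k) :
    U3.der k ((relIdeal k).mkQ a) = (relIdeal k).mkQ (Free.der k a) := rfl

theorem U3.prod_mk (n : ℕ) (a b : Free k) :
    U3.prod k n ((relIdeal k).mkQ a) ((relIdeal k).mkQ b) = (relIdeal k).mkQ (Free.prod k n a b) :=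
  rfl

theorem U3.mk_eq_zero {a : Free k} (h : a ∈ relIdeal k) : (relIdeal k).mkQ a = 0 :=
  (Submodule.Quotient.mk_eq_zero _).2 h

theorem U3.der_prod' (n : ℕ) (a b : U3 k) :
    U3.prod k n (U3.der k a) b = -(n • U3.prod k (n - 1) a b) := by
  obtain ⟨a, rfl⟩ := (relIdeal k).mkQ_surjective a
  obtain ⟨b, rfl⟩ := (relIdeal k).mkQ_surjective b
  have := U3.mk_eq_zero k ((isRelIdeal_relIdeal k).der_prod n a b)
  rw [map_add, map_nsmul, ← U3.prod_mk, ← U3.prod_mk, ← U3.der_mk] at this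
  exact eq_neg_of_add_eq_zero_left this

theorem U3.prod_der' (n : ℕ) (a b : U3 k) :
    U3.prod k n a (U3.der k b) = U3.der k (U3.prod k n a b) + n • U3.prod k (n - 1) a b := by
  obtain ⟨a, rfl⟩ := (relIdeal k).mkQ_surjective a
  obtain ⟨b, rfl⟩ := (relIdeal k).mkQ_surjective b
  have := U3.mk_eq_zero k ((isRelIdeal_relIdeal k).prod_der n a b)
  simp only [map_sub, map_add, map_nsmul, ← U3.prod_mk, ← U3.der_mk] at this
  exact sub_eq_zero.1 this

theorem U3.assoc' (n m : ℕ) (a b c : U3 k) : U3.prod k n a (U3.prod k m b c) =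
    ∑ s ∈ range (n + 1), n.choose s • U3.prod k (m + s) (U3.prod k (n - s) a b) c := by
  obtain ⟨a, rfl⟩ := (relIdeal k).mkQ_surjective a
  obtain ⟨b, rfl⟩ := (relIdeal k).mkQ_surjective b
  obtain ⟨c, rfl⟩ := (relIdeal k).mkQ_surjective c
  have := U3.mk_eq_zero k ((isRelIdeal_relIdeal k).assoc n m a b c)
  simp only [map_sub, map_sum, map_nsmul, ← U3.prod_mk] at this
  exact sub_eq_zero.1 this

theorem U3.loc' (n : ℕ) (hn : 3 ≤ n) : U3.prod k n (U3.v k) (U3.v k) = 0 :=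
  U3.mk_eq_zero k ((isRelIdeal_relIdeal k).loc n hn)

theorem U3.comm' : 2 • U3.prod k 1 (U3.v k) (U3.v k) -
    U3.der k (U3.prod k 2 (U3.v k) (U3.v k)) = 2 • U3.v k := by
  have := U3.mk_eq_zero k (isRelIdeal_relIdeal k).comm
  simp only [map_sub, map_nsmul, ← U3.prod_mk, ← U3.der_mk] at this
  exact sub_eq_zero.1 this

variable {k}

/-- `U(3)` is generated by `v`. -/
theorem U3.induction (T : Submodule k (U3 k)) (hv : U3.v k ∈ T)
    (hd : ∀ a ∈ T, U3.der k a ∈ T) (hp : ∀ n, ∀ a ∈ T, ∀ b ∈ T, U3.prod k n a b ∈ T)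
    (a : U3 k) : a ∈ T := by
  have key : ∀ w : Word, (relIdeal k).mkQ (Finsupp.single w 1) ∈ T := by
    intro w
    induction w with
    | v => exact hv
    | der w ih =>
      have := hd _ ih
      rw [U3.der_mk] at this
      simpa [Free.der] using this
    | prod n w w' ih ih' =>
      have := hp n _ ih _ ih'
      rw [U3.prod_mk] at this
      simpa [Free.prod] using this
  obtain ⟨a, rfl⟩ := (relIdeal k).mkQ_surjective a
  induction a using Finsupp.induction_linear with
  | zero => simp
  | add f g hf hg =>
    rw [map_add]
    exact T.add_mem hf hg
  | single w c =>
    have : (Finsupp.single w c : Free k) = c • Finsupp.single w 1 := by simp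
    rw [this, map_smul]
    exact T.smul_mem _ (key w)

theorem U3.prod_prod_zero {N : ℕ} {a b c : U3 k} (h : ∀ n, N ≤ n → U3.prod k n b c = 0) (m : ℕ) :
    ∀ n, N ≤ n → U3.prod k n (U3.prod k m a b) c = 0 := by
  induction m using Nat.strong_induction_on with
  | _ m ih =>
    intro n hn
    have e := U3.assoc' k m n a b c
    rw [h n hn, map_zero, sum_range_succ'] at e
    rw [sum_eq_zero] at e
    · simpa using e.symm
    · intro s hs
      rw [mem_range] at hs
      rw [ih (m - (s + 1)) (by omega) _ (by omega), smul_zero]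

/-- Every two elements of `U(3)` are local to each other. -/
theorem U3.locality' (a b : U3 k) : ∃ N : ℕ, ∀ n, N ≤ n → U3.prod k n a b = 0 := by
  let L (b : U3 k) : Submodule k (U3 k) :=
    { carrier := {a | ∃ N : ℕ, ∀ n, N ≤ n → U3.prod k n a b = 0}
      zero_mem' := ⟨0, by simp⟩
      add_mem' := by
        rintro x y ⟨N, hN⟩ ⟨N', hN'⟩
        refine ⟨max N N', fun n hn => ?_⟩
        simp [hN n (by omega), hN' n (by omega)]
      smul_mem' := by
        rintro c x ⟨N, hN⟩
        exact ⟨N, fun n hn => by simp [hN n hn]⟩ }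
  have left : ∀ b, U3.v k ∈ L b → ∀ a, a ∈ L b := by
    intro b hb
    refine U3.induction _ hb ?_ ?_
    · rintro a ⟨N, hN⟩
      refine ⟨N + 1, fun n hn => ?_⟩
      rw [U3.der_prod', hN (n - 1) (by omega), smul_zero, neg_zero]
    · rintro m a - a' ⟨N, hN⟩
      exact ⟨N, U3.prod_prod_zero hN m⟩
  let R : Submodule k (U3 k) :=
    { carrier := {b | U3.v k ∈ L b}
      zero_mem' := ⟨0, by simp⟩
      add_mem' := by
        rintro x y ⟨N, hN⟩ ⟨N', hN'⟩
        refine ⟨max N N', fun n hn => ?_⟩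
        simp [hN n (by omega), hN' n (by omega)]
      smul_mem' := by
        rintro c x ⟨N, hN⟩
        exact ⟨N, fun n hn => by simp [hN n hn]⟩ }
  refine left b ?_ a
  refine U3.induction R ⟨3, U3.loc' k⟩ ?_ ?_ b
  · rintro b ⟨N, hN⟩
    refine ⟨N + 1, fun n hn => ?_⟩
    rw [U3.prod_der', hN n (by omega), hN (n - 1) (by omega), map_zero, smul_zero, add_zero]
  · rintro m b ⟨N, hN⟩ b' hb'
    obtain ⟨N', hN'⟩ := left b' hb' b
    refine ⟨N + N', fun n hn => ?_⟩
    rw [U3.assoc']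
    refine sum_eq_zero fun s hs => ?_
    by_cases h : N ≤ n - s
    · rw [hN _ h, map_zero, LinearMap.zero_apply, smul_zero]
    · rw [U3.prod_prod_zero hN' _ _ (by omega), smul_zero]

noncomputable instance : AssocConformalAlgebra k (U3 k) where
  der := U3.der k
  prod := U3.prod k
  locality := U3.locality'
  der_prod := U3.der_prod' k
  prod_der := U3.prod_der' k
  assoc := U3.assoc' k

/-- The universal property of `U(3)`: an element `x` of a space with operations `∂`, `∘ₙ` that
satisfy the identities determines a homomorphism with `v ↦ x` if `x` satisfies the relations. -/
theorem U3.exists_lift {E : Type*} [AddCommGroup E] [Module k E] (dE : E →ₗ[k] E)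
    (pE : ℕ → E →ₗ[k] E →ₗ[k] E) (x : E)
    (der_prod : ∀ (n : ℕ) (a b : E), pE n (dE a) b = -(n • pE (n - 1) a b))
    (prod_der : ∀ (n : ℕ) (a b : E), pE n a (dE b) = dE (pE n a b) + n • pE (n - 1) a b)
    (assoc : ∀ (n m : ℕ) (a b c : E), pE n a (pE m b c) =
      ∑ s ∈ range (n + 1), n.choose s • pE (m + s) (pE (n - s) a b) c)
    (loc : ∀ n, 3 ≤ n → pE n x x = 0)
    (comm : 2 • pE 1 x x - dE (pE 2 x x) = 2 • x) :
    ∃ f : U3 k →ₗ[k] E, f (U3.v k) = x ∧ (∀ a, f (U3.der k a) = dE (f a)) ∧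
      ∀ n a b, f (U3.prod k n a b) = pE n (f a) (f b) := by
  let g : Word → E := fun w => Word.rec x (fun _ y => dE y) (fun n _ _ y z => pE n y z) w
  let F : Free k →ₗ[k] E := Finsupp.linearCombination k g
  have Fv : F (Free.v k) = x := by simp [F, Free.v, g]
  have Fd : ∀ a, F (Free.der k a) = dE (F a) := by
    intro a
    have : F ∘ₗ Free.der k = dE ∘ₗ F := by
      ext w
      simp [F, Free.der, g]
    exact LinearMap.congr_fun this a
  have Fp : ∀ n a b, F (Free.prod k n a b) = pE n (F a) (F b) := by
    intro n a b
    have : (Free.prod k n).compr₂ F = (pE n).compl₁₂ F F := by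
      ext w w'
      simp [F, Free.prod, g]
    exact LinearMap.congr_fun₂ this a b
  have hI : IsRelIdeal k (LinearMap.ker F) := by
    constructor
    · intro a ha
      rw [LinearMap.mem_ker] at *
      rw [Fd, ha, map_zero]
    · intro n a ha b
      rw [LinearMap.mem_ker] at *
      rw [Fp, ha, map_zero, LinearMap.zero_apply]
    · intro n a b hb
      rw [LinearMap.mem_ker] at *
      rw [Fp, hb, map_zero]
    · intro n a b
      rw [LinearMap.mem_ker, map_add, map_nsmul, Fp, Fp, Fd, der_prod, neg_add_cancel]
    · intro n a b
      rw [LinearMap.mem_ker, map_sub, map_add, map_nsmul, Fp, Fp, Fd, Fd, Fp, prod_der, sub_self]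
    · intro n m a b c
      simp only [LinearMap.mem_ker, map_sub, map_sum, map_nsmul, Fp]
      rw [assoc, sub_self]
    · intro n hn
      rw [LinearMap.mem_ker, Fp, Fv, loc n hn]
    · simp only [LinearMap.mem_ker, map_sub, map_nsmul, Fp, Fd, Fv]
      rw [comm, sub_self]
  have hle : relIdeal k ≤ LinearMap.ker F := sInf_le hI
  refine ⟨(relIdeal k).liftQ F hle, Fv, ?_, ?_⟩
  · intro a
    obtain ⟨a, rfl⟩ := (relIdeal k).mkQ_surjective a
    exact Fd a
  · intro n a b
    obtain ⟨a, rfl⟩ := (relIdeal k).mkQ_surjective a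
    obtain ⟨b, rfl⟩ := (relIdeal k).mkQ_surjective b
    exact Fp n a b

end

/-! ### Operations on sequences in an associative algebra -/

section
variable {k R : Type*} [Field k] [Ring R] [Algebra k R]

/-- The shift of a sequence. -/
def seqShift (k R : Type*) [Field k] [Ring R] [Algebra k R] : (ℕ → R) →ₗ[k] (ℕ → R) where
  toFun a m := a (m + 1)
  map_add' _ _ := rfl
  map_smul' _ _ := rfl

/-- `(∂a)(m) = -m a(m-1)`. -/
def seqDer (k R : Type*) [Field k] [Ring R] [Algebra k R] : (ℕ → R) →ₗ[k] (ℕ → R) where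
  toFun a m := -(m • a (m - 1))
  map_add' a b := by
    funext m
    simp [add_comm]
  map_smul' c a := by
    funext m
    simp [smul_comm]

/-- `(a ∘ₙ b)(m) = ∑ₛ (-1)ˢ (n choose s) a(n - s) b(m + s)`, written recursively. -/
def seqProd (k R : Type*) [Field k] [Ring R] [Algebra k R] :
    ℕ → (ℕ → R) →ₗ[k] (ℕ → R) →ₗ[k] (ℕ → R)
  | 0 => LinearMap.mk₂ k (fun a b m => a 0 * b m)
      (fun a a' b => by funext m; simp [add_mul])
      (fun c a b => by funext m; simp)
      (fun a b b' => by funext m; simp [mul_add])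
      (fun c a b => by funext m; simp)
  | n + 1 => (seqProd k R n).comp (seqShift k R) - (seqProd k R n).compl₂ (seqShift k R)

theorem seqProd_zero (a b : ℕ → R) (m : ℕ) : seqProd k R 0 a b m = a 0 * b m := rfl

theorem seqProd_succ (n : ℕ) (a b : ℕ → R) : seqProd k R (n + 1) a b =
    seqProd k R n (seqShift k R a) b - seqProd k R n a (seqShift k R b) := rfl

theorem seqShift_prod (n : ℕ) (a b : ℕ → R) :
    seqShift k R (seqProd k R n a b) = seqProd k R n a (seqShift k R b) := by
  induction n generalizing a b with
  | zero => rfl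
  | succ n ih => rw [seqProd_succ, map_sub, ih, ih, ← seqProd_succ]

theorem seqDer_shift (a : ℕ → R) :
    seqShift k R (seqDer k R a) = seqDer k R (seqShift k R a) - a := by
  funext m
  rcases m with _ | m
  · simp [seqShift, seqDer]
  · simp only [seqShift, seqDer, LinearMap.coe_mk, AddHom.coe_mk, Pi.sub_apply,
      Nat.add_sub_cancel]
    rw [add_smul (m + 1), one_smul]
    abel

theorem seq_der_prod (n : ℕ) (a b : ℕ → R) :
    seqProd k R n (seqDer k R a) b = -(n • seqProd k R (n - 1) a b) := by
  induction n generalizing a b with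
  | zero =>
    funext m
    simp [seqProd_zero, seqDer]
  | succ n ih =>
    rw [seqProd_succ, seqDer_shift, map_sub, LinearMap.sub_apply, ih, ih]
    rcases n with _ | n
    · simp
    · simp only [Nat.add_sub_cancel]
      rw [add_smul (n + 1), one_smul, seqProd_succ n, smul_sub]
      abel

theorem seq_prod_der (n : ℕ) (a b : ℕ → R) :
    seqProd k R n a (seqDer k R b) =
      seqDer k R (seqProd k R n a b) + n • seqProd k R (n - 1) a b := by
  induction n generalizing a b with
  | zero =>
    funext m
    simp only [seqProd_zero, seqDer, LinearMap.coe_mk, AddHom.coe_mk, zero_smul, add_zero]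
    rw [mul_neg, mul_smul_comm]
  | succ n ih =>
    rw [seqProd_succ, seqDer_shift, map_sub, ih, ih]
    rcases n with _ | n
    · simp only [seqProd_succ, map_sub, zero_smul, add_zero, zero_add, one_smul, Nat.sub_self]
      abel
    · simp only [Nat.add_sub_cancel]
      rw [add_smul (n + 1), one_smul, seqProd_succ (n + 1) a b, map_sub, seqProd_succ n a b,
        smul_sub]
      abel

theorem sum_pascal {A : Type*} [AddCommGroup A] (n : ℕ) (F : ℕ → ℕ → A) :
    ∑ s ∈ range (n + 2), (n + 1).choose s • F (n + 1 - s) s =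
      ∑ s ∈ range (n + 1), n.choose s • (F (n - s + 1) s + F (n - s) (s + 1)) := by
  rw [sum_range_succ']
  simp only [Nat.choose_succ_succ, add_smul, sum_add_distrib, Nat.add_sub_add_right, smul_add]
  rw [add_assoc, add_comm]
  congr 1
  rw [sum_range_succ, sum_range_succ' (fun s => n.choose s • F (n - s + 1) s)]
  simp only [Nat.choose_succ_self, zero_smul, add_zero, Nat.choose_zero_right, Nat.sub_zero]
  congr 1
  refine sum_congr rfl fun s hs => ?_
  rw [mem_range] at hs
  rw [show n - (s + 1) + 1 = n - s by omega]

theorem seq_assoc (n m : ℕ) (a b c : ℕ → R) : seqProd k R n a (seqProd k R m b c) =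
    ∑ s ∈ range (n + 1), n.choose s • seqProd k R (m + s) (seqProd k R (n - s) a b) c := by
  induction n generalizing a b c with
  | zero =>
    simp only [zero_add, range_one, sum_singleton, Nat.choose_self, one_smul, add_zero]
    induction m generalizing b c with
    | zero =>
      funext i
      simp [seqProd_zero, mul_assoc]
    | succ m ih => rw [seqProd_succ, map_sub, ih, ih, seqProd_succ, seqShift_prod]
  | succ n ih =>
    rw [sum_pascal n fun i s => seqProd k R (m + s) (seqProd k R i a b) c, seqProd_succ,
      seqShift_prod, ih, ih, ← sum_sub_distrib]
    refine sum_congr rfl fun s _ => ?_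
    rw [← smul_sub, ← add_assoc m s 1, seqProd_succ (m + s), seqProd_succ (n - s), seqShift_prod,
      map_sub, LinearMap.sub_apply]
    congr 1
    abel

theorem seq_act_act (n m : ℕ) (a b : ℕ → R) : a n * b m =
    ∑ s ∈ range (n + 1), n.choose s • seqProd k R (n - s) a b (m + s) := by
  induction n generalizing a b m with
  | zero => simp [seqProd_zero]
  | succ n ih =>
    rw [sum_pascal n fun i s => seqProd k R i a b (m + s)]
    refine (ih m (seqShift k R a) b).trans ?_
    refine sum_congr rfl fun s _ => ?_
    have : seqProd k R (n - s) a b (m + (s + 1)) =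
        seqProd k R (n - s) a (seqShift k R b) (m + s) := by
      rw [← seqShift_prod]
      rfl
    rw [this, seqProd_succ, Pi.sub_apply, sub_add_cancel]

theorem seq_prod_eq_zero {N : ℕ} {a b : ℕ → R}
    (h : ∀ i j, seqProd k R N ((seqShift k R)^[i] a) ((seqShift k R)^[j] b) = 0) (n : ℕ) :
    ∀ i j, seqProd k R (N + n) ((seqShift k R)^[i] a) ((seqShift k R)^[j] b) = 0 := by
  induction n with
  | zero => exact h
  | succ n ih =>
    intro i j
    rw [← add_assoc, seqProd_succ, ← Function.iterate_succ_apply' (seqShift k R),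
      ← Function.iterate_succ_apply' (seqShift k R), ih, ih, sub_zero]

theorem seq_left_mul (n : ℕ) (x : R) (a b : ℕ → R) :
    seqProd k R n (fun i => x * a i) b = fun m => x * seqProd k R n a b m := by
  induction n generalizing a b with
  | zero =>
    funext m
    simp [seqProd_zero, mul_assoc]
  | succ n ih =>
    rw [seqProd_succ, seqProd_succ, ih]
    have := ih (seqShift k R a) b
    funext m
    rw [Pi.sub_apply, Pi.sub_apply, mul_sub]
    exact congrArg (· - _) (congrFun this m)

theorem seq_right_mul (n : ℕ) (x : R) (a b : ℕ → R) :
    seqProd k R n a (fun i => b i * x) = fun m => seqProd k R n a b m * x := by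
  induction n generalizing a b with
  | zero =>
    funext m
    simp [seqProd_zero, mul_assoc]
  | succ n ih =>
    rw [seqProd_succ, seqProd_succ, ih]
    have := ih a (seqShift k R b)
    funext m
    rw [Pi.sub_apply, Pi.sub_apply, sub_mul]
    exact congrArg (_ - ·) (congrFun this m)

theorem seq_mid_mul (n : ℕ) (x : R) (a b : ℕ → R) :
    seqProd k R n (fun i => a i * x) b = seqProd k R n a (fun i => x * b i) := by
  induction n generalizing a b with
  | zero =>
    funext m
    simp [seqProd_zero, mul_assoc]
  | succ n ih =>
    rw [seqProd_succ, seqProd_succ]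
    exact congrArg₂ (· - ·) (ih (seqShift k R a) b) (ih a (seqShift k R b))

/-- If `[x, a] = ∂a` then `[x, ∂a] = ∂∂a`. -/
theorem seq_comm_der (x : R) (a : ℕ → R)
    (ha : (fun i => x * a i) - (fun i => a i * x) = seqDer k R a) :
    (fun i => x * seqDer k R a i) - (fun i => seqDer k R a i * x) =
      seqDer k R (seqDer k R a) := by
  nth_rewrite 3 [← ha]
  funext i
  change x * (-(i • a (i - 1))) - (-(i • a (i - 1))) * x = -(i • (x * a (i - 1) - a (i - 1) * x))
  rw [mul_neg, neg_mul, mul_smul_comm, smul_mul_assoc, smul_sub]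
  abel

/-- If `[x, a] = ∂a` and `[x, b] = ∂b` then `[x, a ∘ₙ b] = ∂(a ∘ₙ b)`. -/
theorem seq_comm_prod (n : ℕ) (x : R) (a b : ℕ → R)
    (ha : (fun i => x * a i) - (fun i => a i * x) = seqDer k R a)
    (hb : (fun i => x * b i) - (fun i => b i * x) = seqDer k R b) :
    (fun i => x * seqProd k R n a b i) - (fun i => seqProd k R n a b i * x) =
      seqDer k R (seqProd k R n a b) := by
  rw [← seq_left_mul, ← seq_right_mul]
  have h1 := congrArg (fun c => seqProd k R n c b) ha
  have h2 := congrArg (fun c => seqProd k R n a c) hb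
  simp only [map_sub, LinearMap.sub_apply, seq_der_prod, seq_prod_der] at h1 h2
  rw [seq_mid_mul] at h1
  rw [← sub_add_sub_cancel, h1, h2]
  abel

end

/-! ### The module `M_{(α, Δ)}` -/

section
variable {k : Type*} [Field k]

open Polynomial

/-- The operators `v(n)` on `k[∂]`: since `(v ∘_λ f(∂)u) = f(∂ + λ) (α + ∂ + Δ λ) u`, one has
`v(n) f = (∂ + α) f⁽ⁿ⁾ + n Δ f⁽ⁿ⁻¹⁾`. -/
noncomputable def virOp (α Δ : k) (n : ℕ) : Module.End k k[X] :=
  LinearMap.mulLeft k (X + C α) * (derivative : Module.End k k[X]) ^ n +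
    (n * Δ) • (derivative : Module.End k k[X]) ^ (n - 1)

theorem derivative_pow_mul_mulLeft (α : k) (n : ℕ) :
    (derivative : Module.End k k[X]) ^ n * LinearMap.mulLeft k (X + C α) =
      LinearMap.mulLeft k (X + C α) * (derivative : Module.End k k[X]) ^ n +
        (n : k) • (derivative : Module.End k k[X]) ^ (n - 1) := by
  have h1 : (derivative : Module.End k k[X]) * LinearMap.mulLeft k (X + C α) =
      LinearMap.mulLeft k (X + C α) * derivative + 1 := by
    refine LinearMap.ext fun f => ?_
    simp [derivative_mul, add_comm]
  induction n with
  | zero => simp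
  | succ n ih =>
    rw [pow_succ', mul_assoc, ih, mul_add, ← mul_assoc, h1, add_mul, one_mul, mul_smul_comm,
      mul_assoc, Nat.add_sub_cancel]
    rcases n with _ | n
    · simp
    · simp only [Nat.add_sub_cancel, ← pow_succ']
      push_cast
      module

theorem virOp_mul (α Δ : k) (n m : ℕ) : virOp α Δ n * virOp α Δ m =
    LinearMap.mulLeft k (X + C α) * LinearMap.mulLeft k (X + C α) *
        (derivative : Module.End k k[X]) ^ (n + m) +
      ((n : k) + Δ * (n + m)) • (LinearMap.mulLeft k (X + C α) *
        (derivative : Module.End k k[X]) ^ (n + m - 1)) +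
      ((n : k) * (n - 1) * Δ + n * m * Δ ^ 2) •
        (derivative : Module.End k k[X]) ^ (n + m - 2) := by
  have h := derivative_pow_mul_mulLeft (k := k) α
  simp only [virOp]
  generalize LinearMap.mulLeft k (X + C α) = L at *
  generalize (derivative : Module.End k k[X]) = D at *
  simp only [mul_add, add_mul, smul_mul_assoc, mul_smul_comm]
  rw [← mul_assoc (L * D ^ n) L, mul_assoc L (D ^ n) L, h n, mul_assoc L (D ^ n) (D ^ (m - 1)),
    ← mul_assoc (D ^ (n - 1)) L, h (n - 1)]
  clear h
  simp only [add_mul, mul_add, mul_assoc, smul_mul_assoc, mul_smul_comm, ← pow_add, smul_add,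
    smul_smul]
  rcases n with _ | _ | n
  · rcases m with _ | m
    · simp
    · simp only [zero_add, Nat.add_sub_cancel, Nat.zero_sub]
      push_cast
      module
  · rcases m with _ | m
    · simp
      module
    · simp only [zero_add, Nat.add_sub_cancel, Nat.sub_self, show 1 + (m + 1) - 1 = m + 1 by omega,
        show 1 + (m + 1) - 2 = m by omega, show 1 + m = m + 1 by omega]
      push_cast
      module
  · rcases m with _ | m
    · simp
      try module
    · simp only [Nat.add_sub_cancel, show n + 1 + 1 + (m + 1) - 1 = n + 1 + 1 + m by omega,
        show n + 1 + 1 + (m + 1) - 2 = n + m + 1 by omega,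
        show n + 1 + (m + 1) = n + 1 + 1 + m by omega,
        show n + (m + 1) = n + m + 1 by omega, show n + 1 + m = n + m + 1 by omega]
      push_cast
      try module

theorem virOp_mul' (α Δ : k) (N n m : ℕ) (h : n + m = N) : virOp α Δ n * virOp α Δ m =
    LinearMap.mulLeft k (X + C α) * LinearMap.mulLeft k (X + C α) *
        (derivative : Module.End k k[X]) ^ N +
      ((n : k) + Δ * N) • (LinearMap.mulLeft k (X + C α) *
        (derivative : Module.End k k[X]) ^ (N - 1)) +
      ((n : k) * (n - 1) * Δ + n * m * Δ ^ 2) •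
        (derivative : Module.End k k[X]) ^ (N - 2) := by
  subst h
  rw [virOp_mul, Nat.cast_add]

theorem virOp_loc (α Δ : k) (n : ℕ) (hn : 3 ≤ n) :
    seqProd k (Module.End k k[X]) n (virOp α Δ) (virOp α Δ) = 0 := by
  obtain ⟨n, rfl⟩ := Nat.exists_eq_add_of_le hn
  have sh : ∀ (j : ℕ) (a : ℕ → Module.End k k[X]) (m : ℕ),
      (seqShift k (Module.End k k[X]))^[j] a m = a (m + j) := by
    intro j
    induction j with
    | zero => intro a m; rfl
    | succ j ih =>
      intro a m
      rw [Function.iterate_succ_apply, ih]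
      rfl
  have sh' : ∀ (a : ℕ → Module.End k k[X]) (m : ℕ),
      seqShift k (Module.End k k[X]) a m = a (m + 1) := fun _ _ => rfl
  have key : ∀ i j, seqProd k (Module.End k k[X]) (0 + 1 + 1 + 1)
      ((seqShift k (Module.End k k[X]))^[i] (virOp α Δ))
      ((seqShift k (Module.End k k[X]))^[j] (virOp α Δ)) = 0 := by
    intro i j
    funext m
    simp only [seqProd_succ, seqProd_zero, Pi.sub_apply, sh', sh, Pi.zero_apply]
    rw [virOp_mul' α Δ (i + j + m + 3) (0 + 1 + 1 + 1 + i) (m + j) (by omega),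
      virOp_mul' α Δ (i + j + m + 3) (0 + 1 + 1 + i) (m + 1 + j) (by omega),
      virOp_mul' α Δ (i + j + m + 3) (0 + 1 + i) (m + 1 + 1 + j) (by omega),
      virOp_mul' α Δ (i + j + m + 3) (0 + i) (m + 1 + 1 + 1 + j) (by omega)]
    push_cast
    module
  exact seq_prod_eq_zero key n 0 0

theorem virOp_comm (α Δ : k) :
    2 • seqProd k (Module.End k k[X]) 1 (virOp α Δ) (virOp α Δ) -
      seqDer k (Module.End k k[X])
        (seqProd k (Module.End k k[X]) 2 (virOp α Δ) (virOp α Δ)) = 2 • virOp α Δ := by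
  funext m
  have e1 : ∀ m, seqProd k (Module.End k k[X]) 1 (virOp α Δ) (virOp α Δ) m =
      virOp α Δ 1 * virOp α Δ m - virOp α Δ 0 * virOp α Δ (m + 1) := fun _ => rfl
  have e2 : ∀ m, seqProd k (Module.End k k[X]) 2 (virOp α Δ) (virOp α Δ) m =
      (virOp α Δ 2 * virOp α Δ m - virOp α Δ 1 * virOp α Δ (m + 1)) -
      (virOp α Δ 1 * virOp α Δ (m + 1) - virOp α Δ 0 * virOp α Δ (m + 1 + 1)) := fun _ => rfl
  have e3 : ∀ a : ℕ → Module.End k k[X], seqDer k (Module.End k k[X]) a m = -(m • a (m - 1)) :=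
    fun _ => rfl
  rw [Pi.sub_apply, Pi.smul_apply, Pi.smul_apply, e1, e3, e2]
  rw [virOp_mul' α Δ (m + 1) 1 m (by omega), virOp_mul' α Δ (m + 1) 0 (m + 1) (by omega)]
  rcases m with _ | m
  · simp only [virOp, Nat.cast_zero, Nat.cast_one, zero_smul, zero_mul, zero_add, Nat.sub_self,
      pow_zero, mul_one]
    module
  · simp only [Nat.add_sub_cancel]
    rw [virOp_mul' α Δ (m + 2) 2 m (by omega),
      virOp_mul' α Δ (m + 2) 1 (m + 1) (by omega),
      virOp_mul' α Δ (m + 2) 0 (m + 1 + 1) (by omega), virOp]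
    simp only [Nat.add_sub_cancel, show m + 1 + 1 - 2 = m by omega, show m + 2 - 1 = m + 1 by omega]
    push_cast
    module

/-- The conformal module `M_{(α, Δ)}`: the free `k[∂]`-module with generator `u = 1`. -/
def VirModule (k : Type*) [Field k] (_α _Δ : k) : Type _ := k[X]

noncomputable instance (α Δ : k) : AddCommGroup (VirModule k α Δ) :=
  inferInstanceAs (AddCommGroup k[X])

noncomputable instance (α Δ : k) : Module k (VirModule k α Δ) :=
  inferInstanceAs (Module k k[X])

theorem exists_virAct (α Δ : k) : ∃ f : U3 k →ₗ[k] (ℕ → Module.End k k[X]),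
    f (U3.v k) = virOp α Δ ∧ (∀ a, f (U3.der k a) = seqDer k _ (f a)) ∧
      ∀ n a b, f (U3.prod k n a b) = seqProd k _ n (f a) (f b) :=
  U3.exists_lift _ _ _ seq_der_prod seq_prod_der seq_assoc (virOp_loc α Δ) (virOp_comm α Δ)

/-- The action `a ↦ (n ↦ a(n))` of `U(3)` on `k[∂]u` that extends that of `v`. -/
noncomputable def virAct (α Δ : k) : U3 k →ₗ[k] (ℕ → Module.End k k[X]) :=
  (exists_virAct α Δ).choose

theorem virAct_v (α Δ : k) : virAct α Δ (U3.v k) = virOp α Δ := (exists_virAct α Δ).choose_spec.1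

theorem virAct_der (α Δ : k) (a : U3 k) : virAct α Δ (U3.der k a) = seqDer k _ (virAct α Δ a) :=
  (exists_virAct α Δ).choose_spec.2.1 a

theorem virAct_prod (α Δ : k) (n : ℕ) (a b : U3 k) :
    virAct α Δ (U3.prod k n a b) = seqProd k _ n (virAct α Δ a) (virAct α Δ b) :=
  (exists_virAct α Δ).choose_spec.2.2 n a b

theorem virAct_comm (α Δ : k) (a : U3 k) :
    (fun i => LinearMap.mulLeft k (X : k[X]) * virAct α Δ a i) -
      (fun i => virAct α Δ a i * LinearMap.mulLeft k (X : k[X])) = seqDer k _ (virAct α Δ a) := by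
  let T : Submodule k (U3 k) :=
    { carrier := {a | (fun i => LinearMap.mulLeft k (X : k[X]) * virAct α Δ a i) -
        (fun i => virAct α Δ a i * LinearMap.mulLeft k (X : k[X])) = seqDer k _ (virAct α Δ a)}
      zero_mem' := by
        funext i
        simp
      add_mem' := by
        intro a b ha hb
        simp only [Set.mem_ofPred_eq, map_add] at *
        rw [← ha, ← hb]
        funext i
        simp only [Pi.add_apply, Pi.sub_apply, mul_add, add_mul]
        abel
      smul_mem' := by
        intro c a ha
        simp only [Set.mem_ofPred_eq, map_smul] at *
        rw [← ha]
        funext i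
        simp only [Pi.smul_apply, Pi.sub_apply, mul_smul_comm, smul_mul_assoc, smul_sub] }
  refine U3.induction T ?_ ?_ ?_ a
  · change _ = _
    rw [virAct_v]
    funext n
    have h0 := derivative_pow_mul_mulLeft (k := k) 0
    rw [C_0, add_zero] at h0
    have h1 : LinearMap.mulLeft k (X : k[X]) * LinearMap.mulLeft k (X + C α) =
        LinearMap.mulLeft k (X + C α) * LinearMap.mulLeft k (X : k[X]) := by
      refine LinearMap.ext fun f => ?_
      simp only [Module.End.mul_apply, LinearMap.mulLeft_apply]
      ring
    simp only [Pi.sub_apply, virOp, seqDer, LinearMap.coe_mk, AddHom.coe_mk, mul_add, add_mul,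
      mul_smul_comm, smul_mul_assoc, mul_assoc, h0]
    rw [← mul_assoc, h1]
    rcases n with _ | n
    · simp
    · simp only [mul_assoc, Nat.add_sub_cancel]
      rcases n with _ | n
      · simp
      · push_cast
        module
  · intro a ha
    change _ = _
    rw [virAct_der]
    exact seq_comm_der _ _ ha
  · intro n a ha b hb
    change _ = _
    rw [virAct_prod]
    exact seq_comm_prod n _ _ _ ha hb

theorem virAct_locality (α Δ : k) (a : U3 k) :
    ∀ f : k[X], ∃ N : ℕ, ∀ n, N ≤ n → virAct α Δ a n f = 0 := by
  let T : Submodule k (U3 k) :=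
    { carrier := {a | ∀ f : k[X], ∃ N : ℕ, ∀ n, N ≤ n → virAct α Δ a n f = 0}
      zero_mem' := fun f => ⟨0, by simp⟩
      add_mem' := by
        intro a b ha hb f
        obtain ⟨N, hN⟩ := ha f
        obtain ⟨N', hN'⟩ := hb f
        exact ⟨max N N', fun n hn => by simp [hN n (by omega), hN' n (by omega)]⟩
      smul_mem' := by
        intro c a ha f
        obtain ⟨N, hN⟩ := ha f
        exact ⟨N, fun n hn => by simp [hN n hn]⟩ }
  refine U3.induction T ?_ ?_ ?_ a
  · intro f
    refine ⟨f.natDegree + 2, fun n hn => ?_⟩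
    have h : ∀ m, f.natDegree < m → ((derivative : Module.End k k[X]) ^ m) f = 0 := by
      intro m hm
      rw [Module.End.pow_apply]
      exact iterate_derivative_eq_zero hm
    simp [virAct_v, virOp, h n (by omega), h (n - 1) (by omega)]
  · intro a ha f
    obtain ⟨N, hN⟩ := ha f
    refine ⟨N + 1, fun n hn => ?_⟩
    rw [virAct_der]
    simp [seqDer, hN (n - 1) (by omega)]
  · intro n a _ b hb f
    obtain ⟨N, hN⟩ := hb f
    refine ⟨N, ?_⟩
    rw [virAct_prod]
    generalize virAct α Δ a = x
    generalize virAct α Δ b = y at hN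
    induction n generalizing x y with
    | zero =>
      intro m hm
      simp [seqProd_zero, hN m hm]
    | succ n ih =>
      intro m hm
      rw [seqProd_succ, Pi.sub_apply, LinearMap.sub_apply, ih _ _ hN m hm,
        ih x (seqShift k _ y) (fun i hi => hN (i + 1) (by omega)) m hm, sub_zero]

noncomputable instance (α Δ : k) : ConformalModule k (U3 k) (VirModule k α Δ) where
  mder := LinearMap.mulLeft k (X : k[X])
  act n := (LinearMap.proj n).comp (virAct α Δ)
  locality := virAct_locality α Δ
  der_act n a u := by
    have := LinearMap.congr_fun (congrFun (virAct_der α Δ a) n) u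
    exact this
  act_mder n a u := by
    have := LinearMap.congr_fun (congrFun (virAct_comm α Δ a) n) u
    refine (sub_eq_iff_eq_add'.1 ?_)
    refine (neg_sub _ _).symm.trans ((congrArg Neg.neg this).trans ?_)
    exact neg_neg _
  act_act n m a b u := by
    have := LinearMap.congr_fun (seq_act_act (k := k) n m (virAct α Δ a) (virAct α Δ b)) u
    refine this.trans ((LinearMap.sum_apply _ _ _).trans ?_)
    refine sum_congr rfl fun s _ => ?_
    exact congrArg (fun x : ℕ → Module.End k k[X] => (n.choose s • x (m + s)) u)
      (virAct_prod α Δ (n - s) a b).symm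

/-- The generator `u` of `M_{(α, Δ)} = k[∂]u`. -/
noncomputable def VirModule.gen (α Δ : k) : VirModule k α Δ := (1 : k[X])

/-- The action of `v` on the generator: `(v ∘_λ u) = (α + ∂ + Δ λ) u`. -/
theorem act_v_gen (α Δ : k) (n : ℕ) :
    ConformalModule.act (k := k) n (U3.v k) (VirModule.gen α Δ) =
      if n = 0 then
        α • VirModule.gen α Δ + ConformalModule.mder (k := k) (C := U3 k) (VirModule.gen α Δ)
      else if n = 1 then Δ • VirModule.gen α Δ else 0 := by
  have h : virAct α Δ (U3.v k) n (1 : k[X]) =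
      if n = 0 then α • (1 : k[X]) + X * 1 else if n = 1 then Δ • (1 : k[X]) else 0 := by
    rw [virAct_v]
    rcases n with _ | _ | n
    · simp [virOp, smul_eq_C_mul, add_comm]
    · simp [virOp]
    · have : ∀ m, ((derivative : Module.End k k[X]) ^ (m + 1)) 1 = 0 := by
        intro m
        rw [pow_succ, Module.End.mul_apply, derivative_one, map_zero]
      simp [virOp, this]
  exact h

end

end VirasoroU3

/-!
Modulo `∂ + λ` a cochain `φ_λ : C → M[λ]` of degree one is the same as the `k[∂]`-linear map
`φ_{-∂} : C → M` (`reduce`). In degree two the quotient by `∂ + λ₁ + λ₂` is computed by the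
substitution `λ₂ = -∂ - λ₁`, and under it `dφ` becomes
`a ∘_{λ₁} φ_{-∂}(b) - φ_{-∂}(a ∘_{λ₁} b)`. Hence reduced cocycles of degree one are homomorphisms of
left conformal `C`-modules `C → M` (`mem_reducedCocycles_one_iff`). Both facts come from division
with remainder by `λ + D` in `V[λ]` for an endomorphism `D` of `V` (`addVar_divVar`), with `V = M`,
`D = ∂` in degree one and `V = M[λ₁]`, `D = ∂ + λ₁` in degree two.

A homomorphism `g : U(3) → M` is determined by `f = g(v)`, and `f` satisfies `v(n) f = 0` for
`n ≥ 3` and `2 v(1) f - ∂ (v(2) f) = 2 f`. Conversely each such `f` occurs (`exists_hom`): the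
element `(v, f)` of the split extension `U(3) ⊕ M`, where `M` is an ideal with zero right action,
satisfies the defining relations of `U(3)`.

For `M = M_{(α, Δ)} = k[∂] u` and `Δ ≠ 0` the relations with `n = 3, 4` force `f = (x ∂ + y) u`
(`derivative_derivative_eq_zero`), and the remaining one becomes `α x = (1 - Δ) y`. The coboundaries
are spanned by that of `u`, which corresponds to `f = ((1 - Δ) ∂ + α) u`. If `Δ = 1` and `α = 0`
this is zero while `x`, `y` are arbitrary; otherwise it spans the space of solutions.
-/

namespace ConformalCohomology

/-! ### Division by `λ + D` in `V[λ]` -/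

section
variable {k V W : Type*} [Field k] [AddCommGroup V] [Module k V] [AddCommGroup W] [Module k W]

/-- Multiplication by `λ` on `V[λ]`. Here and below `V[λ]` is encoded as `ℕ →₀ V` through the
coefficients of the divided powers `λⁿ / n!`, so that `λ` sends `x` in degree `n` to `(n + 1) x` in
degree `n + 1`. -/
noncomputable def mulVar (k V : Type*) [Field k] [AddCommGroup V] [Module k V] :
    (ℕ →₀ V) →ₗ[k] (ℕ →₀ V) :=
  Finsupp.lsum k fun n => ((n + 1 : ℕ) : k) • Finsupp.lsingle (n + 1)

/-- Multiplication by `λ + D` on `V[λ]`. -/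
noncomputable def addVar (D : Module.End k V) : (ℕ →₀ V) →ₗ[k] (ℕ →₀ V) :=
  Finsupp.mapRange.linearMap D + mulVar k V

/-- The substitution `λ = -D` in `V[λ]`. -/
noncomputable def evalNeg (D : Module.End k V) : (ℕ →₀ V) →ₗ[k] V :=
  Finsupp.lsum k fun n => ((n.factorial : k)⁻¹) • (-D) ^ n

/-- The quotient of `(λⁿ / n!) x` by `λ + D`. If `g = (λ + D) q + r` with `r = g(-D)` then
`λ g = (λ + D) (λ q + r) - D r`, so that the quotient of `λ g` is `λ q + r`; this gives the
recursion. -/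
noncomputable def quotSingle (D : Module.End k V) : ℕ → V →ₗ[k] (ℕ →₀ V)
  | 0 => 0
  | n + 1 => ((n + 1 : ℕ) : k)⁻¹ • (mulVar k V ∘ₗ quotSingle D n +
      Finsupp.lsingle 0 ∘ₗ evalNeg D ∘ₗ Finsupp.lsingle n)

/-- The quotient of the division by `λ + D` in `V[λ]`; the remainder is `evalNeg D`. -/
noncomputable def divVar (D : Module.End k V) : (ℕ →₀ V) →ₗ[k] (ℕ →₀ V) :=
  Finsupp.lsum k (quotSingle D)

theorem mulVar_single (n : ℕ) (x : V) :
    mulVar k V (Finsupp.single n x) = Finsupp.single (n + 1) (((n + 1 : ℕ) : k) • x) := by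
  simp [mulVar]

theorem mulVar_apply (g : ℕ →₀ V) (n : ℕ) : mulVar k V g n = n • g (n - 1) := by
  induction g using Finsupp.induction_linear with
  | zero => simp
  | add f g hf hg => simp [hf, hg]
  | single m x =>
    rw [mulVar_single]
    rcases n with _ | n
    · simp
    · rcases eq_or_ne m n with rfl | h
      · simp [← Nat.cast_smul_eq_nsmul k]
      · simp [h]

theorem addVar_single (D : Module.End k V) (n : ℕ) (x : V) : addVar D (Finsupp.single n x) =
    Finsupp.single n (D x) + Finsupp.single (n + 1) (((n + 1 : ℕ) : k) • x) := by
  simp [addVar, mulVar_single]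

theorem addVar_apply (D : Module.End k V) (g : ℕ →₀ V) (n : ℕ) :
    addVar D g n = D (g n) + n • g (n - 1) := by
  simp [addVar, mulVar_apply]

theorem evalNeg_single (D : Module.End k V) (n : ℕ) (x : V) :
    evalNeg D (Finsupp.single n x) = ((n.factorial : k)⁻¹) • ((-D) ^ n) x := by
  simp [evalNeg]

theorem divVar_single (D : Module.End k V) (n : ℕ) (x : V) :
    divVar D (Finsupp.single n x) = quotSingle D n x := by
  simp [divVar]

theorem addVar_mulVar (D : Module.End k V) (g : ℕ →₀ V) :
    addVar D (mulVar k V g) = mulVar k V (addVar D g) := by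
  induction g using Finsupp.induction_linear with
  | zero => simp
  | add f g hf hg => simp [hf, hg]
  | single m x => simp only [addVar_single, mulVar_single, map_add, map_smul]

/-- A linear map that intertwines `D` and `D'` intertwines the substitutions `λ = -D`, `λ = -D'`. -/
theorem evalNeg_mapRange (D : Module.End k V) (D' : Module.End k W) (f : V →ₗ[k] W)
    (h : ∀ x, f (D x) = D' (f x)) (g : ℕ →₀ V) :
    evalNeg D' (Finsupp.mapRange.linearMap f g) = f (evalNeg D g) := by
  have hp : ∀ (n : ℕ) (x : V), f (((-D) ^ n) x) = ((-D') ^ n) (f x) := by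
    intro n
    induction n with
    | zero => simp
    | succ n ih =>
      intro x
      rw [pow_succ, pow_succ, Module.End.mul_apply, Module.End.mul_apply, ih]
      simp [h]
  induction g using Finsupp.induction_linear with
  | zero => simp
  | add f g hf hg => simp only [map_add, hf, hg]
  | single m x =>
    rw [Finsupp.mapRange.linearMap_apply, Finsupp.mapRange_single, evalNeg_single, evalNeg_single,
      map_smul, hp]

theorem mapRange_mulVar (f : V →ₗ[k] W) (g : ℕ →₀ V) :
    Finsupp.mapRange.linearMap f (mulVar k V g) =
      mulVar k W (Finsupp.mapRange.linearMap f g) := by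
  ext n
  simp [mulVar_apply]

theorem mapRange_addVar (D : Module.End k V) (D' : Module.End k W) (f : V →ₗ[k] W)
    (h : ∀ x, f (D x) = D' (f x)) (g : ℕ →₀ V) :
    Finsupp.mapRange.linearMap f (addVar D g) = addVar D' (Finsupp.mapRange.linearMap f g) := by
  ext n
  simp [addVar_apply, h]

theorem addVar_injective [CharZero k] (D : Module.End k V) :
    Function.Injective (addVar D) := by
  rw [injective_iff_map_eq_zero]
  intro g hg
  by_contra h0
  have hne : g.support.Nonempty := Finsupp.support_nonempty_iff.2 h0
  -- the leading coefficient of `(λ + D) g` is that of `λ g`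
  have hN := Finset.max'_mem _ hne
  set N := g.support.max' hne
  have h1 : g (N + 1) = 0 := by
    by_contra h
    have := g.support.le_max' (N + 1) (Finsupp.mem_support_iff.2 h)
    omega
  have h2 := DFunLike.congr_fun hg (N + 1)
  rw [addVar_apply, h1, map_zero, zero_add, Nat.add_sub_cancel, Finsupp.zero_apply,
    ← Nat.cast_smul_eq_nsmul k, smul_eq_zero] at h2
  exact h2.elim (by exact_mod_cast Nat.succ_ne_zero N) (Finsupp.mem_support_iff.1 hN)

theorem evalNeg_single_succ (D : Module.End k V) (n : ℕ) (x : V) :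
    evalNeg D (Finsupp.single (n + 1) x) =
      -(((n + 1 : ℕ) : k)⁻¹ • D (evalNeg D (Finsupp.single n x))) := by
  rw [evalNeg_single, evalNeg_single, pow_succ', Module.End.mul_apply, Nat.factorial_succ,
    Nat.cast_mul, mul_inv, mul_smul, map_smul]
  simp

theorem evalNeg_mulVar [CharZero k] (D : Module.End k V) (g : ℕ →₀ V) :
    evalNeg D (mulVar k V g) = -D (evalNeg D g) := by
  induction g using Finsupp.induction_linear with
  | zero => simp
  | add f g hf hg => simp only [map_add, hf, hg, neg_add]
  | single n x =>
    have : ((n + 1 : ℕ) : k) ≠ 0 := by exact_mod_cast Nat.succ_ne_zero n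
    rw [mulVar_single, ← Finsupp.smul_single, map_smul, evalNeg_single_succ, smul_neg,
      smul_inv_smul₀ this]

theorem evalNeg_addVar [CharZero k] (D : Module.End k V) (g : ℕ →₀ V) :
    evalNeg D (addVar D g) = 0 := by
  rw [addVar, LinearMap.add_apply, map_add, evalNeg_mulVar,
    evalNeg_mapRange D D D (fun _ => rfl), add_neg_cancel]

/-- Division with remainder by `λ + D`. -/
theorem addVar_divVar [CharZero k] (D : Module.End k V) (g : ℕ →₀ V) :
    addVar D (divVar D g) = g - Finsupp.single 0 (evalNeg D g) := by
  induction g using Finsupp.induction_linear with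
  | zero => simp
  | add f g hf hg =>
    simp only [map_add, hf, hg, Finsupp.single_add]
    abel
  | single n x =>
    rw [divVar_single]
    induction n with
    | zero => simp [quotSingle, evalNeg_single]
    | succ n ih =>
      have : ((n + 1 : ℕ) : k) ≠ 0 := by exact_mod_cast Nat.succ_ne_zero n
      simp only [quotSingle, LinearMap.smul_apply, LinearMap.add_apply, LinearMap.comp_apply,
        Finsupp.lsingle_apply, map_smul, map_add, addVar_mulVar, ih, map_sub, mulVar_single,
        addVar_single, evalNeg_single_succ, Finsupp.single_neg]
      simp only [zero_add, Nat.cast_one, one_smul, sub_add_add_cancel, smul_add,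
        Finsupp.smul_single, inv_smul_smul₀ this]
      simp only [sub_neg_eq_add]

end

/-! ### Divided powers and the substitution `λ ↦ λ₁ + λ₂` -/

section
variable {k V : Type*} [Field k] [AddCommGroup V] [Module k V]

/-- Multiplication by the divided power `λˢ / s!` on `V[λ]`. -/
noncomputable def mulPow (k V : Type*) [Field k] [AddCommGroup V] [Module k V] :
    ℕ → (ℕ →₀ V) →ₗ[k] (ℕ →₀ V)
  | 0 => LinearMap.id
  | s + 1 => ((s + 1 : ℕ) : k)⁻¹ • (mulVar k V ∘ₗ mulPow k V s)

theorem mulPow_apply [CharZero k] (s : ℕ) (g : ℕ →₀ V) (p : ℕ) :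
    mulPow k V s g p = p.choose s • g (p - s) := by
  induction s generalizing p with
  | zero => simp [mulPow]
  | succ s ih =>
    have hs : ((s + 1 : ℕ) : k) ≠ 0 := by exact_mod_cast Nat.succ_ne_zero s
    simp only [mulPow, LinearMap.smul_apply, LinearMap.comp_apply, Finsupp.smul_apply,
      mulVar_apply, ih]
    rw [inv_smul_eq_iff₀ hs, Nat.cast_smul_eq_nsmul, smul_smul, smul_smul]
    rcases p with _ | p
    · simp
    · rw [Nat.add_sub_cancel, Nat.add_one_mul_choose_eq, mul_comm, Nat.add_sub_add_right]

theorem addVar_mulPow (D : Module.End k V) (s : ℕ) (g : ℕ →₀ V) :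
    addVar D (mulPow k V s g) = mulPow k V s (addVar D g) := by
  induction s with
  | zero => rfl
  | succ s ih => simp only [mulPow, LinearMap.smul_apply, LinearMap.comp_apply, map_smul,
      addVar_mulVar, ih]

theorem mulPow_single_zero [CharZero k] (s : ℕ) (x : V) :
    mulPow k V s (Finsupp.single 0 x) = Finsupp.single s x := by
  induction s with
  | zero => rfl
  | succ s ih =>
    have hs : ((s + 1 : ℕ) : k) ≠ 0 := by exact_mod_cast Nat.succ_ne_zero s
    simp only [mulPow, LinearMap.smul_apply, LinearMap.comp_apply, ih, mulVar_single,
      Finsupp.smul_single, inv_smul_smul₀ hs]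

/-- The substitution `λ ↦ λ₁ + λ₂`, from `V[λ]` to `V[λ₁][λ₂]`. In
`V[λ₁][λ₂]`, that is `ℕ →₀ (ℕ →₀ V)`, the outer index belongs to `λ₂` and the inner one to `λ₁`. -/
noncomputable def addSubst (k V : Type*) [Field k] [AddCommGroup V] [Module k V] :
    (ℕ →₀ V) →ₗ[k] (ℕ →₀ (ℕ →₀ V)) :=
  Finsupp.lsum k fun n => ∑ p ∈ range (n + 1), Finsupp.lsingle (n - p) ∘ₗ Finsupp.lsingle p

theorem addSubst_apply (g : ℕ →₀ V) (q p : ℕ) : addSubst k V g q p = g (p + q) := by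
  induction g using Finsupp.induction_linear with
  | zero => simp
  | add f g hf hg => simp [hf, hg]
  | single n x =>
    simp only [addSubst, Finsupp.lsum_single, LinearMap.sum_apply, LinearMap.comp_apply,
      Finsupp.lsingle_apply, Finsupp.coe_finsetSum, Finset.sum_apply]
    by_cases h : n = p + q
    · subst h
      rw [sum_eq_single p]
      · simp
      · intro p' hp' hne
        rw [mem_range] at hp'
        rw [Finsupp.single_eq_of_ne (by omega)]
        rfl
      · simp
    · rw [Finsupp.single_eq_of_ne (Ne.symm h)]
      refine sum_eq_zero fun p' hp' => ?_
      rw [mem_range] at hp'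
      by_cases h1 : q = n - p'
      · rw [← h1, Finsupp.single_eq_same, Finsupp.single_eq_of_ne (by omega)]
      · rw [Finsupp.single_eq_of_ne h1]
        rfl

/-- The substitution `λ ↦ λ₁ + λ₂` turns multiplication by `λ` into that by `λ₁ + λ₂`. -/
theorem addSubst_mulVar (g : ℕ →₀ V) : addSubst k V (mulVar k V g) =
    Finsupp.mapRange.linearMap (mulVar k V) (addSubst k V g) +
      mulVar k (ℕ →₀ V) (addSubst k V g) := by
  ext q p
  simp only [addSubst_apply, mulVar_apply, Finsupp.add_apply, Finsupp.mapRange.linearMap_apply,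
    Finsupp.mapRange_apply, Finsupp.smul_apply, add_smul]
  rcases p with _ | p
  · simp
  · rcases q with _ | q
    · simp
    · congr 3
      omega

/-- Substituting `λ₂ = -D - λ₁` into `g(λ₁ + λ₂)` gives `g(-D)`. -/
theorem evalNeg_addSubst [CharZero k] (D : Module.End k V) (g : ℕ →₀ V) :
    evalNeg (addVar D) (addSubst k V g) = Finsupp.single 0 (evalNeg D g) := by
  induction g using Finsupp.induction_linear with
  | zero => simp
  | add f g hf hg => simp only [map_add, hf, hg, Finsupp.single_add]
  | single n x =>
    induction n with
    | zero => simp [addSubst, evalNeg_single]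
    | succ n ih =>
      have hn : ((n + 1 : ℕ) : k) ≠ 0 := by exact_mod_cast Nat.succ_ne_zero n
      have e : (Finsupp.single (n + 1) x : ℕ →₀ V) =
          ((n + 1 : ℕ) : k)⁻¹ • mulVar k V (Finsupp.single n x) := by
        rw [mulVar_single, Finsupp.smul_single, inv_smul_smul₀ hn]
      rw [e, map_smul, map_smul, map_smul, addSubst_mulVar, map_add, evalNeg_mulVar,
        evalNeg_mapRange (addVar D) (addVar D) _ fun y => (addVar_mulVar D y).symm, ih,
        evalNeg_mulVar, addVar_single, mulVar_single]
      simp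

end

/-! ### Cochains as linear maps -/

section
variable (k : Type*) {C M : Type*} [Field k] [AddCommGroup C] [Module k C]
  [AssocConformalAlgebra k C] [AddCommGroup M] [Module k M]

variable (C) in
/-- The operator `∂` on `C`. -/
abbrev partialC : Module.End k C := AssocConformalAlgebra.der (k := k)

variable {k}

/-- The family of coefficients of a map `T : C → M[λ]`. -/
noncomputable def ofLinear (T : C →ₗ[k] (ℕ →₀ M)) : Coeffs k C M 1 := fun p a => T (a 0) (p 0)

/-- The family of coefficients of a bilinear map `C × C → M[λ₁][λ₂]`. -/
noncomputable def ofBilinear (T : C →ₗ[k] C →ₗ[k] (ℕ →₀ (ℕ →₀ M))) : Coeffs k C M 2 :=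
  fun p a => T (a 0) (a 1) (p 1) (p 0)

theorem ofLinear_mem {T : C →ₗ[k] (ℕ →₀ M)}
    (hT : ∀ a, T (partialC k C a) = -mulVar k M (T a)) : ofLinear T ∈ cochains k C M 1 := by
  refine ⟨?_, ?_, ?_, ?_⟩
  · intro p a i x y
    obtain rfl := Subsingleton.elim 0 i
    simp [ofLinear]
  · intro p a i c x
    obtain rfl := Subsingleton.elim 0 i
    simp [ofLinear]
  · intro a
    refine Set.Finite.of_injOn (f := fun p : Fin 1 → ℕ => p 0) (t := (T (a 0)).support) ?_ ?_
      (Finset.finite_toSet _)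
    · intro p hp
      simpa [ofLinear] using hp
    · intro p _ q _ h
      funext i
      obtain rfl := Subsingleton.elim 0 i
      exact h
  · intro p a i
    obtain rfl := Subsingleton.elim 0 i
    have := DFunLike.congr_fun (hT (a 0)) (p 0)
    simpa [ofLinear, mulVar_apply] using this

theorem ofBilinear_mem {T : C →ₗ[k] C →ₗ[k] (ℕ →₀ (ℕ →₀ M))}
    (h₁ : ∀ a b, T (partialC k C a) b = -Finsupp.mapRange.linearMap (mulVar k M) (T a b))
    (h₂ : ∀ a b, T a (partialC k C b) = -mulVar k (ℕ →₀ M) (T a b)) :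
    ofBilinear T ∈ cochains k C M 2 := by
  refine ⟨?_, ?_, ?_, ?_⟩
  · intro p a i x y
    fin_cases i <;> simp [ofBilinear]
  · intro p a i c x
    fin_cases i <;> simp [ofBilinear]
  · intro a
    refine Set.Finite.of_injOn (f := fun p : Fin 2 → ℕ => (p 1, p 0))
      (t := (T (a 0) (a 1)).uncurry.support) ?_ ?_ (Finset.finite_toSet _)
    · intro p hp
      simpa [ofBilinear] using hp
    · intro p _ q _ h
      simp only [Prod.mk.injEq] at h
      funext i
      fin_cases i
      · exact h.2
      · exact h.1
  · intro p a i
    fin_cases i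
    · have := DFunLike.congr_fun (DFunLike.congr_fun (h₁ (a 0) (a 1)) (p 1)) (p 0)
      simpa [ofBilinear, mulVar_apply] using this
    · have := DFunLike.congr_fun (DFunLike.congr_fun (h₂ (a 0) (a 1)) (p 1)) (p 0)
      simpa [ofBilinear, mulVar_apply] using this

theorem update_const {X : Type*} (x y : X) :
    Function.update (fun _ : Fin 1 => x) 0 y = fun _ => y := by
  funext i
  obtain rfl := Subsingleton.elim 0 i
  simp

variable (k C M) in
/-- A cochain of degree one as a linear map `C → M[λ]`. -/
noncomputable def toLinear : cochains k C M 1 →ₗ[k] C →ₗ[k] (ℕ →₀ M) where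
  toFun φ :=
    { toFun := fun a => Finsupp.ofSupportFinite (fun n => φ.1 (fun _ => n) fun _ => a) <|
        Set.Finite.of_injOn (f := fun n (_ : Fin 1) => n) (t := {p | φ.1 p (fun _ => a) ≠ 0})
          (fun _ h => h) (fun _ _ _ _ h => congrFun h 0) (φ.2.2.2.1 _)
      map_add' := by
        intro x y
        ext n
        have := φ.2.1 (fun _ => n) (fun _ => x) 0 x y
        simpa [Finsupp.ofSupportFinite_coe, update_const] using this
      map_smul' := by
        intro c x
        ext n
        have := φ.2.2.1 (fun _ => n) (fun _ => x) 0 c x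
        simpa [Finsupp.ofSupportFinite_coe, update_const] using this }
  map_add' φ ψ := by
    ext a n
    rfl
  map_smul' c φ := by
    ext a n
    rfl

theorem toLinear_apply (φ : cochains k C M 1) (a : C) (n : ℕ) :
    toLinear k C M φ a n = φ.1 (fun _ => n) fun _ => a := rfl

theorem ofLinear_toLinear (φ : cochains k C M 1) : ofLinear (toLinear k C M φ) = φ.1 := by
  funext p a
  rw [ofLinear, toLinear_apply]
  exact congrArg₂ φ.1 (funext fun i => congrArg p (Subsingleton.elim 0 i))
    (funext fun i => congrArg a (Subsingleton.elim 0 i))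

theorem toLinear_ofLinear {T : C →ₗ[k] (ℕ →₀ M)}
    (hT : ∀ a, T (partialC k C a) = -mulVar k M (T a)) :
    toLinear k C M ⟨ofLinear T, ofLinear_mem hT⟩ = T := by
  ext a n
  rfl

theorem toLinear_der (φ : cochains k C M 1) (a : C) :
    toLinear k C M φ (partialC k C a) = -mulVar k M (toLinear k C M φ a) := by
  ext n
  have := φ.2.2.2.2 (fun _ => n) (fun _ => a) 0
  simpa [toLinear_apply, mulVar_apply, update_const] using this

end

/-! ### Action and product as polynomials in `λ` -/

section
variable (k : Type*) {C M : Type*} [Field k] [AddCommGroup C] [Module k C]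
  [AssocConformalAlgebra k C] [AddCommGroup M] [Module k M] [ConformalModule k C M]

variable (C M) in
/-- The operator `∂` on `M`. -/
abbrev partialM : Module.End k M := ConformalModule.mder (k := k) (C := C)

theorem finite_of_locality {V : Type*} [AddCommGroup V] {f : ℕ → V}
    (h : ∃ N : ℕ, ∀ n, N ≤ n → f n = 0) : (Function.support f).Finite := by
  obtain ⟨N, hN⟩ := h
  refine (Set.finite_Iio N).subset fun n hn => ?_
  by_contra h'
  exact hn (hN n (not_lt.1 h'))

variable (M) in
/-- `u ↦ a ∘_λ u`. -/
noncomputable def actVar (a : C) : M →ₗ[k] (ℕ →₀ M) where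
  toFun u := Finsupp.ofSupportFinite (fun n => ConformalModule.act (k := k) n a u)
    (finite_of_locality (ConformalModule.locality a u))
  map_add' u w := by
    ext n
    simp [Finsupp.ofSupportFinite_coe]
  map_smul' c u := by
    ext n
    simp [Finsupp.ofSupportFinite_coe]

/-- `a ∘_λ b`. -/
noncomputable def prodVar (a b : C) : ℕ →₀ C :=
  Finsupp.ofSupportFinite (fun n => AssocConformalAlgebra.prod (k := k) n a b)
    (finite_of_locality (AssocConformalAlgebra.locality a b))

theorem actVar_apply (a : C) (u : M) (n : ℕ) :
    actVar k M a u n = ConformalModule.act (k := k) n a u := rfl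

theorem prodVar_apply (a b : C) (n : ℕ) :
    prodVar k a b n = AssocConformalAlgebra.prod (k := k) n a b := rfl

theorem actVar_der (a : C) (u : M) :
    actVar k M (partialC k C a) u = -mulVar k M (actVar k M a u) := by
  ext n
  simp [actVar_apply, mulVar_apply, ConformalModule.der_act]

theorem actVar_mder (a : C) (u : M) :
    actVar k M a (partialM k C M u) = addVar (partialM k C M) (actVar k M a u) := by
  ext n
  simp [actVar_apply, addVar_apply, ConformalModule.act_mder]

theorem prodVar_der_left (a b : C) :
    prodVar k (partialC k C a) b = -mulVar k C (prodVar k a b) := by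
  ext n
  simp [prodVar_apply, mulVar_apply, AssocConformalAlgebra.der_prod]

theorem prodVar_der_right (a b : C) :
    prodVar k a (partialC k C b) = addVar (partialC k C) (prodVar k a b) := by
  ext n
  simp [prodVar_apply, addVar_apply, AssocConformalAlgebra.prod_der]

variable {k}

theorem partialOp_ofLinear (T : C →ₗ[k] (ℕ →₀ M)) (p : Fin 1 → ℕ) (a : Fin 1 → C) :
    partialOp k C M 1 (ofLinear T) p a = addVar (partialM k C M) (T (a 0)) (p 0) := by
  simp [partialOp, ofLinear, addVar_apply]

end

/-! ### The reduced differential -/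

section
variable {k C M : Type*} [Field k] [AddCommGroup C] [Module k C] [AddCommGroup M] [Module k M]

/-- For `c = ∑ₛ (λ₁ˢ / s!) cₛ` this is `∑ₛ (λ₁ˢ / s!) T_{λ₁ + λ₂}(cₛ)`, where
`T_λ` is the value of `T` as a polynomial in `λ`. -/
noncomputable def substProd (T : C →ₗ[k] (ℕ →₀ M)) : (ℕ →₀ C) →ₗ[k] (ℕ →₀ (ℕ →₀ M)) :=
  Finsupp.lsum k fun s => Finsupp.mapRange.linearMap (mulPow k M s) ∘ₗ addSubst k M ∘ₗ T

theorem substProd_single (T : C →ₗ[k] (ℕ →₀ M)) (s : ℕ) (c : C) :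
    substProd T (Finsupp.single s c) =
      Finsupp.mapRange.linearMap (mulPow k M s) (addSubst k M (T c)) := by
  simp [substProd]

theorem substProd_prodVar_apply [AssocConformalAlgebra k C] [CharZero k] (T : C →ₗ[k] (ℕ →₀ M))
    (a b : C) (q p : ℕ) :
    substProd T (prodVar k a b) q p = ∑ s ∈ range (p + 1),
      p.choose s • T (AssocConformalAlgebra.prod (k := k) s a b) (p + q - s) := by
  have e : ∀ c : ℕ →₀ C, substProd T c q p =
      c.sum fun s x => p.choose s • T x (p - s + q) := by
    intro c
    induction c using Finsupp.induction_linear with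
    | zero => simp
    | add f g hf hg =>
      rw [map_add, Finsupp.add_apply, Finsupp.add_apply, hf, hg, Finsupp.sum_add_index'] <;> simp
    | single s x =>
      rw [substProd_single, Finsupp.sum_single_index (by simp)]
      simp [mulPow_apply, addSubst_apply]
  rw [e, Finsupp.sum]
  refine (sum_subset (subset_union_left (s₂ := range (p + 1))) ?_).trans
    ((sum_subset (subset_union_right (s₁ := (prodVar k a b).support)) ?_).symm.trans ?_)
  · intro s _ hs
    rw [Finsupp.notMem_support_iff.1 hs]
    simp
  · intro s _ hs
    rw [mem_range, not_lt] at hs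
    rw [Nat.choose_eq_zero_of_lt (by omega), zero_smul]
  · refine sum_congr rfl fun s hs => ?_
    rw [mem_range] at hs
    rw [prodVar_apply, show p - s + q = p + q - s by omega]

theorem substProd_mulVar [CharZero k] (T : C →ₗ[k] (ℕ →₀ M)) (c : ℕ →₀ C) :
    substProd T (mulVar k C c) = Finsupp.mapRange.linearMap (mulVar k M) (substProd T c) := by
  induction c using Finsupp.induction_linear with
  | zero => simp
  | add f g hf hg => simp only [map_add, hf, hg]
  | single s x =>
    have hs : ((s + 1 : ℕ) : k) ≠ 0 := by exact_mod_cast Nat.succ_ne_zero s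
    rw [mulVar_single, substProd_single, substProd_single]
    ext q p
    simp only [Finsupp.mapRange.linearMap_apply, Finsupp.mapRange_apply, mulPow, map_smul,
      LinearMap.smul_apply, LinearMap.comp_apply, Finsupp.smul_apply, smul_inv_smul₀ hs]

theorem substProd_mapRange_der [AssocConformalAlgebra k C] [CharZero k] {T : C →ₗ[k] (ℕ →₀ M)}
    (hT : ∀ a, T (partialC k C a) = -mulVar k M (T a)) (c : ℕ →₀ C) :
    substProd T (Finsupp.mapRange.linearMap (partialC k C) c) =
      -(Finsupp.mapRange.linearMap (mulVar k M) (substProd T c) +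
        mulVar k (ℕ →₀ M) (substProd T c)) := by
  have hc : ∀ s (y : ℕ →₀ M), mulPow k M s (mulVar k M y) = mulVar k M (mulPow k M s y) := by
    intro s y
    induction s with
    | zero => rfl
    | succ s ih => simp only [mulPow, LinearMap.smul_apply, LinearMap.comp_apply, map_smul, ih]
  induction c using Finsupp.induction_linear with
  | zero => simp
  | add f g hf hg =>
    simp only [map_add, hf, hg]
    abel
  | single s x =>
    rw [Finsupp.mapRange.linearMap_apply, Finsupp.mapRange_single, substProd_single,
      substProd_single, hT, map_neg, map_neg, addSubst_mulVar, map_add, mapRange_mulVar]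
    congr 2
    ext q : 1
    simp [hc]

/-- The values of a cochain of degree two are polynomials in `λ₁`, `λ₂`. -/
theorem exists_eq_of_mem_cochains_two [AssocConformalAlgebra k C] {θ : Coeffs k C M 2}
    (hθ : θ ∈ cochains k C M 2) (a b : C) :
    ∃ g : ℕ →₀ (ℕ →₀ M), ∀ q p, g q p = θ ![p, q] ![a, b] := by
  refine ⟨(Finsupp.ofSupportFinite (fun x : ℕ × ℕ => θ ![x.2, x.1] ![a, b]) ?_).curry,
    fun q p => rfl⟩
  refine Set.Finite.of_injOn (f := fun x : ℕ × ℕ => ![x.2, x.1])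
    (t := {p | θ p ![a, b] ≠ 0}) (fun _ h => h) ?_ (hθ.2.2.1 _)
  intro x _ y _ h
  exact Prod.ext (congrFun h 1) (congrFun h 0)

end

section
variable {k C M : Type*} [Field k] [AddCommGroup C] [Module k C] [AssocConformalAlgebra k C]
  [AddCommGroup M] [Module k M] [ConformalModule k C M]

variable (k C M) in
/-- The reduction of cochains of degree one modulo `∂`: `φ_λ` is sent to `φ_λ|_{λ = -∂}`. -/
noncomputable def reduce : cochains k C M 1 →ₗ[k] C →ₗ[k] M :=
  LinearMap.compRight k (evalNeg (partialM k C M)) ∘ₗ toLinear k C M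

theorem reduce_apply (φ : cochains k C M 1) (a : C) :
    reduce k C M φ a = evalNeg (partialM k C M) (toLinear k C M φ a) := rfl

/-- A cochain of degree one is divisible by `∂ + λ` if its reduction vanishes. -/
theorem mem_map_partialOp_of_reduce_eq_zero [CharZero k] (φ : cochains k C M 1)
    (h : ∀ a, reduce k C M φ a = 0) :
    φ.1 ∈ (cochains k C M 1).map (partialOp k C M 1) := by
  have e : ∀ a, addVar (partialM k C M) (divVar (partialM k C M) (toLinear k C M φ a)) =
      toLinear k C M φ a := by
    intro a
    rw [addVar_divVar, ← reduce_apply, h, Finsupp.single_zero, sub_zero]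
  refine ⟨ofLinear (divVar (partialM k C M) ∘ₗ toLinear k C M φ), ofLinear_mem fun a => ?_, ?_⟩
  · refine addVar_injective (partialM k C M) ?_
    simp only [LinearMap.comp_apply]
    rw [e, toLinear_der, map_neg, addVar_mulVar, e]
  · funext p a
    rw [partialOp_ofLinear, LinearMap.comp_apply, e, ← ofLinear_toLinear φ]
    rfl

theorem reduce_eq_zero_of_mem_map_partialOp [CharZero k] (φ : cochains k C M 1)
    (h : φ.1 ∈ (cochains k C M 1).map (partialOp k C M 1)) (a : C) :
    reduce k C M φ a = 0 := by
  obtain ⟨ψ, hψ, e⟩ := h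
  have : toLinear k C M φ a = addVar (partialM k C M) (toLinear k C M ⟨ψ, hψ⟩ a) := by
    ext n
    have e' := partialOp_ofLinear (toLinear k C M ⟨ψ, hψ⟩) (fun _ => n) fun _ => a
    rw [ofLinear_toLinear] at e'
    rw [toLinear_apply, ← e, e']
  rw [reduce_apply, this, evalNeg_addVar]

theorem reduce_der [CharZero k] (φ : cochains k C M 1) (a : C) :
    reduce k C M φ (partialC k C a) = partialM k C M (reduce k C M φ a) := by
  rw [reduce_apply, toLinear_der, map_neg, evalNeg_mulVar, neg_neg, ← reduce_apply]

/-- The substitution `λ₂ = -∂ - λ₁` in `φ_{λ₁ + λ₂}(a ∘_{λ₁} b)`. -/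
theorem evalNeg_substProd [CharZero k] (φ : cochains k C M 1) (c : ℕ →₀ C) :
    evalNeg (addVar (partialM k C M)) (substProd (toLinear k C M φ) c) =
      Finsupp.mapRange.linearMap (reduce k C M φ) c := by
  induction c using Finsupp.induction_linear with
  | zero => simp
  | add f g hf hg => simp only [map_add, hf, hg]
  | single s x =>
    rw [substProd_single, evalNeg_mapRange (addVar (partialM k C M)) (addVar (partialM k C M)) _
      fun y => (addVar_mulPow _ s y).symm, evalNeg_addSubst, mulPow_single_zero,
      Finsupp.mapRange.linearMap_apply, Finsupp.mapRange_single, reduce_apply]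

/-- The differential of the cochain `T` of degree one, with values in `M[λ₁][λ₂]`. -/
noncomputable def dLinear [CharZero k] (T : C →ₗ[k] (ℕ →₀ M)) :
    C →ₗ[k] C →ₗ[k] (ℕ →₀ (ℕ →₀ M)) :=
  LinearMap.mk₂ k
    (fun a b => Finsupp.mapRange.linearMap (actVar k M a) (T b) - substProd T (prodVar k a b))
    (fun a a' b => by
      ext q p
      simp only [Finsupp.sub_apply, Finsupp.add_apply, substProd_prodVar_apply,
        Finsupp.mapRange.linearMap_apply, Finsupp.mapRange_apply, actVar_apply, map_add,
        LinearMap.add_apply, smul_add, sum_add_distrib]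
      abel)
    (fun c a b => by
      ext q p
      simp only [Finsupp.sub_apply, Finsupp.smul_apply, substProd_prodVar_apply,
        Finsupp.mapRange.linearMap_apply, Finsupp.mapRange_apply, actVar_apply, map_smul,
        LinearMap.smul_apply, smul_sub, smul_sum]
      simp only [smul_comm c])
    (fun a b b' => by
      ext q p
      simp only [Finsupp.sub_apply, Finsupp.add_apply, substProd_prodVar_apply,
        Finsupp.mapRange.linearMap_apply, Finsupp.mapRange_apply, actVar_apply, map_add,
        smul_add, sum_add_distrib]
      abel)
    (fun c a b => by
      ext q p
      simp only [Finsupp.sub_apply, Finsupp.smul_apply, substProd_prodVar_apply,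
        Finsupp.mapRange.linearMap_apply, Finsupp.mapRange_apply, actVar_apply, map_smul,
        smul_sub, smul_sum]
      simp only [smul_comm c])

theorem dLinear_apply [CharZero k] (T : C →ₗ[k] (ℕ →₀ M)) (a b : C) : dLinear T a b =
    Finsupp.mapRange.linearMap (actVar k M a) (T b) - substProd T (prodVar k a b) := rfl

/-- `dLinear` is the Hochschild differential in degree one. -/
theorem d_ofLinear [CharZero k] (T : C →ₗ[k] (ℕ →₀ M)) :
    d k C M 1 (ofLinear T) = ofBilinear (dLinear T) := by
  funext p a
  rw [ofBilinear, dLinear_apply, Finsupp.sub_apply, Finsupp.sub_apply, substProd_prodVar_apply,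
    sub_eq_add_neg]
  simp only [d, LinearMap.coe_mk, AddHom.coe_mk, univ_unique, sum_singleton, ofLinear]
  simp [Fin.tail, actVar_apply, Fin.contractNth]

theorem dLinear_der_left [CharZero k] (T : C →ₗ[k] (ℕ →₀ M)) (a b : C) :
    dLinear T (partialC k C a) b = -Finsupp.mapRange.linearMap (mulVar k M) (dLinear T a b) := by
  rw [dLinear_apply, dLinear_apply, prodVar_der_left, map_neg, substProd_mulVar, map_sub, neg_sub,
    sub_neg_eq_add, add_comm, sub_eq_add_neg]
  congr 1
  ext q : 1
  simp [actVar_der]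

theorem dLinear_der_right [CharZero k] {T : C →ₗ[k] (ℕ →₀ M)}
    (hT : ∀ a, T (partialC k C a) = -mulVar k M (T a)) (a b : C) :
    dLinear T a (partialC k C b) = -mulVar k (ℕ →₀ M) (dLinear T a b) := by
  rw [dLinear_apply, dLinear_apply, prodVar_der_right, hT, map_neg, mapRange_mulVar, addVar,
    LinearMap.add_apply, map_add, substProd_mapRange_der hT, substProd_mulVar, map_sub]
  abel

/-- Substituting `λ₂ = -∂ - λ₁` into `(dφ)_{λ₁, λ₂}(a, b)` measures the failure of the reduction of
`φ` to be a homomorphism of left modules. -/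
theorem evalNeg_dLinear_apply [CharZero k] (φ : cochains k C M 1) (a b : C) (n : ℕ) :
    evalNeg (addVar (partialM k C M)) (dLinear (toLinear k C M φ) a b) n =
      ConformalModule.act (k := k) n a (reduce k C M φ b) -
        reduce k C M φ (AssocConformalAlgebra.prod (k := k) n a b) := by
  rw [dLinear_apply, map_sub, evalNeg_substProd,
    evalNeg_mapRange (partialM k C M) _ _ (actVar_mder k a)]
  rfl

theorem partialOp_ofBilinear (T : C →ₗ[k] C →ₗ[k] (ℕ →₀ (ℕ →₀ M))) (p : Fin 2 → ℕ)
    (a : Fin 2 → C) : partialOp k C M 2 (ofBilinear T) p a =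
      addVar (addVar (partialM k C M)) (T (a 0) (a 1)) (p 1) (p 0) := by
  simp [partialOp, ofBilinear, addVar_apply, Fin.sum_univ_two, add_assoc]

/-- The reduced cocycles of degree one are the cochains whose reduction is a homomorphism of left
modules. -/
theorem mem_reducedCocycles_one_iff [CharZero k] (φ : cochains k C M 1) :
    φ.1 ∈ reducedCocycles k C M 1 ↔ ∀ n a b,
      reduce k C M φ (AssocConformalAlgebra.prod (k := k) n a b) =
        ConformalModule.act (k := k) n a (reduce k C M φ b) := by
  set T := toLinear k C M φ
  set P := addVar (partialM k C M)
  have hd : d k C M 1 φ.1 = ofBilinear (dLinear T) := by rw [← ofLinear_toLinear φ, d_ofLinear]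
  constructor
  · rintro ⟨-, θ, hθ, e⟩ n a b
    obtain ⟨g, hg⟩ := exists_eq_of_mem_cochains_two hθ a b
    have : dLinear T a b = addVar P g := by
      ext q p
      have e' := congrFun₂ (e.trans hd) ![p, q] ![a, b]
      refine Eq.trans e'.symm ?_
      have u0 : ∀ r, Function.update ![p, q] 0 r = ![r, q] := by
        intro r
        ext i
        fin_cases i <;> rfl
      have u1 : ∀ r, Function.update ![p, q] 1 r = ![p, r] := by
        intro r
        ext i
        fin_cases i <;> rfl
      simp [partialOp, addVar_apply, P, hg, Fin.sum_univ_two, u0, u1, add_assoc]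
    have h := evalNeg_dLinear_apply φ a b n
    rw [this, evalNeg_addVar, Finsupp.zero_apply] at h
    exact (sub_eq_zero.1 h.symm).symm
  · intro h
    have e : ∀ a b, addVar P (divVar P (dLinear T a b)) = dLinear T a b := by
      intro a b
      have : evalNeg P (dLinear T a b) = 0 := by
        ext n
        rw [evalNeg_dLinear_apply, h, sub_self, Finsupp.zero_apply]
      rw [addVar_divVar, this, Finsupp.single_zero, sub_zero]
    refine ⟨φ.2, ofBilinear ((dLinear T).compr₂ (divVar P)), ofBilinear_mem ?_ ?_, ?_⟩
    · intro a b
      refine addVar_injective P ?_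
      simp only [LinearMap.compr₂_apply]
      rw [e, dLinear_der_left, map_neg,
        ← mapRange_addVar P P _ fun y => (addVar_mulVar (partialM k C M) y).symm, e]
    · intro a b
      refine addVar_injective P ?_
      simp only [LinearMap.compr₂_apply]
      rw [e, dLinear_der_right (toLinear_der φ), map_neg, addVar_mulVar, e]
    · rw [hd]
      funext p a
      rw [partialOp_ofBilinear, LinearMap.compr₂_apply, e]
      rfl

/-- The basic cochain `a ↦ a ∘_λ u`, the differential of `u ∈ M = C̃⁰`. -/
noncomputable def coboundary (u : M) : C →ₗ[k] (ℕ →₀ M) where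
  toFun a := actVar k M a u
  map_add' a b := by
    ext n
    simp [actVar_apply]
  map_smul' c a := by
    ext n
    simp [actVar_apply]

theorem coboundary_mem (u : M) :
    ofLinear (coboundary (k := k) (C := C) u) ∈ cochains k C M 1 :=
  ofLinear_mem fun a => actVar_der k a u

/-- The coboundaries of basic cochains of degree zero are the maps `a ↦ a ∘_λ u`. -/
theorem mem_map_d_zero_iff {ψ : Coeffs k C M 1} : ψ ∈ (cochains k C M 0).map (d k C M 0) ↔
    ∃ u : M, ofLinear (coboundary (k := k) (C := C) u) = ψ := by
  have e : ∀ φ : Coeffs k C M 0, d k C M 0 φ =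
      ofLinear (coboundary (k := k) (C := C) (φ Fin.elim0 Fin.elim0)) := by
    intro φ
    funext p a
    simp only [d, LinearMap.coe_mk, AddHom.coe_mk, univ_eq_empty, sum_empty, add_zero, ofLinear]
    rw [Subsingleton.elim (Fin.tail p) Fin.elim0, Subsingleton.elim (Fin.tail a) Fin.elim0]
    rfl
  constructor
  · rintro ⟨φ, -, rfl⟩
    exact ⟨_, (e φ).symm⟩
  · rintro ⟨u, rfl⟩
    exact ⟨fun _ _ => u, ⟨fun _ _ i => i.elim0, fun _ _ i => i.elim0, fun _ => Set.toFinite _,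
      fun _ _ i => i.elim0⟩, e _⟩

theorem coboundary_mem_reducedCocycles [CharZero k] (u : M) :
    ofLinear (coboundary (k := k) (C := C) u) ∈ reducedCocycles k C M 1 := by
  have h : dLinear (coboundary (k := k) (C := C) u) = 0 := by
    ext a b q p
    rw [dLinear_apply, Finsupp.sub_apply, Finsupp.sub_apply, substProd_prodVar_apply]
    change ConformalModule.act (k := k) p a (ConformalModule.act (k := k) q b u) - _ = 0
    rw [ConformalModule.act_act, sub_eq_zero, ← sum_range_reflect]
    refine sum_congr rfl fun s hs => ?_
    rw [mem_range] at hs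
    rw [show p + 1 - 1 - s = p - s by omega, Nat.choose_symm (by omega),
      show p - (p - s) = s by omega, show q + (p - s) = p + q - s by omega]
    rfl
  refine ⟨coboundary_mem u, ?_⟩
  change d k C M 1 (ofLinear (coboundary u)) ∈ (cochains k C M 2).map (partialOp k C M 2)
  rw [d_ofLinear, h]
  exact Submodule.zero_mem _

end

end ConformalCohomology

namespace VirasoroU3

open ConformalCohomology

/-! ### Left module homomorphisms from `U(3)` -/

section
variable {k M : Type*} [Field k] [AddCommGroup M] [Module k M] [ConformalModule k (U3 k) M]

variable (k M) in
/-- The elements of a module over `U(3)` which satisfy the relations obtained from the defining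
relations of `U(3)` when the last factor `v` is replaced by the element. -/
def relVectors : Submodule k M where
  carrier := {f | (∀ n, 3 ≤ n → ConformalModule.act (k := k) n (U3.v k) f = 0) ∧
    2 • ConformalModule.act (k := k) 1 (U3.v k) f -
      partialM k (U3 k) M (ConformalModule.act (k := k) 2 (U3.v k) f) = 2 • f}
  zero_mem' := by simp
  add_mem' := by
    rintro f g ⟨hf, hf'⟩ ⟨hg, hg'⟩
    refine ⟨fun n hn => by rw [map_add, hf n hn, hg n hn, add_zero], ?_⟩
    rw [smul_add, ← hf', ← hg']
    simp only [map_add, smul_add]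
    abel
  smul_mem' := by
    rintro c f ⟨hf, hf'⟩
    refine ⟨fun n hn => by rw [map_smul, hf n hn, smul_zero], ?_⟩
    rw [smul_comm, ← hf']
    simp only [map_smul, smul_sub, smul_comm c]

/-- Left module homomorphisms `U(3) → M` with prescribed value at `v`. They are obtained from the
universal property of `U(3)`, applied to the split extension `U(3) ⊕ M` in which `M` is an ideal
with zero right action. -/
theorem exists_hom {f : M} (hf : f ∈ relVectors k M) : ∃ g : U3 k →ₗ[k] M, g (U3.v k) = f ∧
    (∀ a, g (U3.der k a) = partialM k (U3 k) M (g a)) ∧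
      ∀ n a b, g (U3.prod k n a b) = ConformalModule.act (k := k) n a (g b) := by
  let dE : U3 k × M →ₗ[k] U3 k × M := LinearMap.prodMap (U3.der k) (partialM k (U3 k) M)
  let pE : ℕ → U3 k × M →ₗ[k] U3 k × M →ₗ[k] U3 k × M := fun n =>
    LinearMap.mk₂ k (fun x y => (U3.prod k n x.1 y.1, ConformalModule.act (k := k) n x.1 y.2))
      (fun x x' y => by simp) (fun c x y => by simp) (fun x y y' => by simp)
      (fun c x y => by simp)
  obtain ⟨F, hv, hd, hp⟩ := U3.exists_lift dE pE (U3.v k, f)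
    (fun n a b => Prod.ext (U3.der_prod' k n a.1 b.1) (ConformalModule.der_act n a.1 b.2))
    (fun n a b => Prod.ext (U3.prod_der' k n a.1 b.1) (ConformalModule.act_mder n a.1 b.2))
    (fun n m a b c => by
      refine Prod.ext ((U3.assoc' k n m a.1 b.1 c.1).trans ?_)
        ((ConformalModule.act_act n m a.1 b.1 c.2).trans ?_)
      · simp [pE, Prod.fst_sum]
      · simp only [pE, Prod.snd_sum]
        rfl)
    (fun n hn => Prod.ext (U3.loc' k n hn) (hf.1 n hn))
    (Prod.ext (U3.comm' k) hf.2)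
  -- the first component of `F` is an endomorphism of `U(3)` which fixes `v`
  have hF : ∀ a, (F a).1 = a := by
    intro a
    refine U3.induction (LinearMap.eqLocus (LinearMap.fst k (U3 k) M ∘ₗ F) LinearMap.id)
      ?_ ?_ ?_ a
    · simp [hv]
    · intro a ha
      simp only [LinearMap.mem_eqLocus, LinearMap.comp_apply, LinearMap.fst_apply,
        LinearMap.id_apply] at ha ⊢
      rw [hd]
      exact congrArg (U3.der k) ha
    · intro n a ha b hb
      simp only [LinearMap.mem_eqLocus, LinearMap.comp_apply, LinearMap.fst_apply,
        LinearMap.id_apply] at ha hb ⊢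
      rw [hp]
      exact congrArg₂ (fun x y => U3.prod k n x y) ha hb
  refine ⟨LinearMap.snd k (U3 k) M ∘ₗ F, ?_, ?_, ?_⟩
  · simp [hv]
  · intro a
    simp [hd, dE]
  · intro n a b
    have : (F (U3.prod k n a b)).2 = ConformalModule.act (k := k) n (F a).1 (F b).2 := by
      rw [hp]
      rfl
    rw [hF] at this
    exact this

variable (k M) in
/-- The value at `v` of the reduction of a reduced cocycle. -/
noncomputable def evalCocycle : reducedCocycles k (U3 k) M 1 →ₗ[k] M :=
  LinearMap.applyₗ (U3.v k) ∘ₗ reduce k (U3 k) M ∘ₗ Submodule.inclusion inf_le_left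

theorem evalCocycle_apply (φ : reducedCocycles k (U3 k) M 1) :
    evalCocycle k M φ = reduce k (U3 k) M ⟨φ.1, φ.2.1⟩ (U3.v k) := rfl

/-- A reduced cocycle is determined, modulo `∂`, by its value at the generator. -/
theorem evalCocycle_eq_zero_iff [CharZero k] (φ : reducedCocycles k (U3 k) M 1) :
    evalCocycle k M φ = 0 ↔
    φ.1 ∈ (cochains k (U3 k) M 1).map (partialOp k (U3 k) M 1) := by
  rw [evalCocycle_apply]
  constructor
  · intro h
    refine mem_map_partialOp_of_reduce_eq_zero ⟨φ.1, φ.2.1⟩ fun a => ?_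
    have hφ := (mem_reducedCocycles_one_iff ⟨φ.1, φ.2.1⟩).1 φ.2
    refine U3.induction (LinearMap.ker (reduce k (U3 k) M ⟨φ.1, φ.2.1⟩)) h ?_ ?_ a
    · intro a ha
      exact (reduce_der _ a).trans (by rw [LinearMap.mem_ker.1 ha, map_zero])
    · intro n a _ b hb
      exact (hφ n a b).trans (by rw [LinearMap.mem_ker.1 hb, map_zero])
  · intro h
    exact reduce_eq_zero_of_mem_map_partialOp ⟨φ.1, φ.2.1⟩ h _

theorem evalCocycle_mem [CharZero k] (φ : reducedCocycles k (U3 k) M 1) :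
    evalCocycle k M φ ∈ relVectors k M := by
  have hφ := (mem_reducedCocycles_one_iff ⟨φ.1, φ.2.1⟩).1 φ.2
  have hd := reduce_der (⟨φ.1, φ.2.1⟩ : cochains k (U3 k) M 1)
  rw [evalCocycle_apply]
  constructor
  · intro n hn
    rw [← hφ]
    exact (congrArg _ (U3.loc' k n hn)).trans (map_zero _)
  · have e := congrArg (reduce k (U3 k) M ⟨φ.1, φ.2.1⟩) (U3.comm' k)
    rw [map_sub, map_nsmul, map_nsmul] at e
    rw [← hφ, ← hφ, ← hd]
    exact e

/-- `L` plays the role of `f(∂) u ↦ f(-λ) u`: it lifts reduced cochains to cochains. -/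
theorem range_evalCocycle [CharZero k] (L : M →ₗ[k] (ℕ →₀ M))
    (hL : ∀ x, L (partialM k (U3 k) M x) = -mulVar k M (L x))
    (hL' : ∀ x, evalNeg (partialM k (U3 k) M) (L x) = x) :
    LinearMap.range (evalCocycle k M) = relVectors k M := by
  refine le_antisymm ?_ fun f hf => ?_
  · rintro _ ⟨φ, rfl⟩
    exact evalCocycle_mem φ
  · obtain ⟨g, hv, hd, hp⟩ := exists_hom hf
    have hT : ∀ a, (L ∘ₗ g) (partialC k (U3 k) a) = -mulVar k M ((L ∘ₗ g) a) := fun a =>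
      (congrArg L (hd a)).trans (hL _)
    have hr : ∀ a, reduce k (U3 k) M ⟨ofLinear (L ∘ₗ g), ofLinear_mem hT⟩ a = g a := by
      intro a
      rw [reduce_apply, toLinear_ofLinear hT]
      exact hL' _
    refine ⟨⟨ofLinear (L ∘ₗ g), (mem_reducedCocycles_one_iff ⟨_, ofLinear_mem hT⟩).2 ?_⟩, ?_⟩
    · intro n a b
      rw [hr, hr]
      exact hp n a b
    · rw [evalCocycle_apply, hr, hv]

theorem evalCocycle_coboundary [CharZero k] (u : M) :
    evalCocycle k M ⟨ofLinear (coboundary u), coboundary_mem_reducedCocycles u⟩ =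
      evalNeg (partialM k (U3 k) M) (actVar k M (U3.v k) u) := rfl

end

/-! ### The modules `M_{(α, Δ)}` -/

section
variable {k : Type*} [Field k]

open Polynomial

/-- The identification `f ↦ f(∂) u` of `k[X]` with `M_{(α, Δ)}`. -/
noncomputable def VirModule.of (α Δ : k) : k[X] ≃ₗ[k] VirModule k α Δ := LinearEquiv.refl k k[X]

/-- The action of `v` on `M_{(α, Δ)}` in terms of polynomials. -/
theorem act_v_of (α Δ : k) (n : ℕ) (f : k[X]) :
    ConformalModule.act (k := k) n (U3.v k) (VirModule.of α Δ f) =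
      VirModule.of α Δ (virOp α Δ n f) := by
  change virAct α Δ (U3.v k) n f = _
  rw [virAct_v]
  rfl

theorem mder_of (α Δ : k) (f : k[X]) :
    partialM k (U3 k) (VirModule k α Δ) (VirModule.of α Δ f) = VirModule.of α Δ (X * f) := rfl

theorem virOp_apply (α Δ : k) (n : ℕ) (f : k[X]) : virOp α Δ n f =
    (X + C α) * derivative^[n] f + C (n * Δ) * derivative^[n - 1] f := by
  simp [virOp, Module.End.pow_apply, smul_eq_C_mul]

/-- The locality relations `v(n) f = 0`, `n ≥ 3`, force `f` to be of degree at most one. -/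
theorem derivative_derivative_eq_zero [CharZero k] {α Δ : k} (hΔ : Δ ≠ 0) {f : k[X]}
    (h : ∀ n, 3 ≤ n → virOp α Δ n f = 0) : derivative (derivative f) = 0 := by
  have e3 := h 3 le_rfl
  have e4 := h 4 (by omega)
  simp only [virOp_apply, Function.iterate_succ_apply', Function.iterate_zero, id,
    Nat.add_one_sub_one] at e3 e4
  set g := derivative (derivative f)
  have e3' := congrArg derivative e3
  simp only [derivative_add, derivative_mul, derivative_X, derivative_C, derivative_zero] at e3'
  -- compare the derivative of the relation for `n = 3` with the relation for `n = 4`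
  have e5 : C (1 - Δ) * derivative g = 0 := by
    simp only [map_mul, map_sub, map_natCast, map_one] at e3' e4 ⊢
    push_cast at e3' e4
    linear_combination e3' - e4
  by_cases hΔ1 : Δ = 1
  · subst hΔ1
    by_contra hg
    -- the leading coefficient of `(X + α) g' + 3 g` is `deg g + 3` times that of `g`
    have e := congrArg (fun p => coeff p g.natDegree) e3
    have hc : coeff ((X + C α) * derivative g) g.natDegree = g.natDegree * g.leadingCoeff := by
      have h1 : coeff (derivative g) g.natDegree = 0 := by
        rw [coeff_derivative, coeff_eq_zero_of_natDegree_lt (by omega), zero_mul]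
      rw [add_mul, coeff_add, coeff_C_mul, h1, mul_zero, add_zero, leadingCoeff]
      rcases g.natDegree with _ | d
      · simp
      · rw [coeff_X_mul, coeff_derivative]
        push_cast
        ring
    simp only [coeff_add, hc, coeff_C_mul, coeff_zero] at e
    rw [← leadingCoeff, ← add_mul, mul_eq_zero] at e
    refine e.elim (fun h => ?_) (leadingCoeff_ne_zero.2 hg)
    have : ((g.natDegree + 3 : ℕ) : k) = 0 := by
      push_cast at h ⊢
      linear_combination h
    exact absurd (Nat.cast_eq_zero.1 this) (by omega)
  · have hg : derivative g = 0 :=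
      (mul_eq_zero.1 e5).resolve_left (C_ne_zero.2 (sub_ne_zero.2 (Ne.symm hΔ1)))
    rw [hg, mul_zero, zero_add] at e3
    exact (mul_eq_zero.1 e3).resolve_left
      (C_ne_zero.2 (mul_ne_zero (by exact_mod_cast (by norm_num : (3 : ℕ) ≠ 0)) hΔ))

/-- The values at `v` of left module homomorphisms `U(3) → M_{(α, Δ)}`. -/
theorem of_mem_relVectors_iff [CharZero k] {α Δ : k} (hΔ : Δ ≠ 0) (f : k[X]) :
    VirModule.of α Δ f ∈ relVectors k (VirModule k α Δ) ↔
      ∃ x y : k, f = C x * X + C y ∧ α * x = (1 - Δ) * y := by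
  have hact : VirModule.of α Δ f ∈ relVectors k (VirModule k α Δ) ↔
      (∀ n, 3 ≤ n → virOp α Δ n f = 0) ∧
        2 • virOp α Δ 1 f - X * virOp α Δ 2 f = 2 • f := by
    refine and_congr (forall₂_congr fun n _ => ?_) ?_
    · rw [act_v_of, LinearEquiv.map_eq_zero_iff]
    · rw [act_v_of, act_v_of, mder_of, ← map_nsmul, ← map_nsmul, ← map_sub]
      exact (VirModule.of α Δ).injective.eq_iff
  have hcomm : ∀ x y : k, 2 • virOp α Δ 1 (C x * X + C y) - X * virOp α Δ 2 (C x * X + C y) =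
      2 • (C x * X + C y) ↔ α * x = (1 - Δ) * y := by
    intro x y
    have e : 2 • virOp α Δ 1 (C x * X + C y) - X * virOp α Δ 2 (C x * X + C y) -
        2 • (C x * X + C y) = 2 * C (α * x - (1 - Δ) * y) := by
      simp only [virOp_apply, Function.iterate_succ_apply', Function.iterate_zero, id,
        Nat.add_one_sub_one, derivative_add, derivative_mul, derivative_C, derivative_X,
        derivative_zero, derivative_one, map_mul, map_sub, map_natCast, map_one, Nat.sub_self]
      push_cast
      ring
    rw [← sub_eq_zero, e, mul_eq_zero, or_iff_right two_ne_zero, C_eq_zero, sub_eq_zero]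
  rw [hact]
  constructor
  · rintro ⟨h, h'⟩
    have h2 := derivative_derivative_eq_zero hΔ h
    obtain ⟨x, hx⟩ : ∃ x, derivative f = C x :=
      ⟨_, eq_C_of_natDegree_eq_zero (derivative_eq_zero.1 h2)⟩
    obtain ⟨y, hy⟩ : ∃ y, f - C x * X = C y :=
      ⟨_, eq_C_of_natDegree_eq_zero (derivative_eq_zero.1 (by simp [hx]))⟩
    have hf : f = C x * X + C y := (sub_eq_iff_eq_add'.1 hy)
    rw [hf] at h'
    exact ⟨x, y, hf, (hcomm x y).1 h'⟩
  · rintro ⟨x, y, hf, hxy⟩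
    rw [hf]
    refine ⟨fun n hn => ?_, (hcomm x y).2 hxy⟩
    obtain ⟨n, rfl⟩ := Nat.exists_eq_add_of_le' hn
    simp [virOp_apply]

/-- The map `f(∂) u ↦ f(-λ) u`. -/
noncomputable def substNeg (α Δ : k) : VirModule k α Δ →ₗ[k] (ℕ →₀ VirModule k α Δ) :=
  (Polynomial.lsum fun n => ((-1) ^ n * (n.factorial : k)) •
    (Finsupp.lsingle n ∘ₗ LinearMap.toSpanSingleton k _ (VirModule.of α Δ 1))) ∘ₗ
      (VirModule.of α Δ).symm.toLinearMap

theorem substNeg_monomial (α Δ : k) (n : ℕ) : substNeg α Δ (VirModule.of α Δ (monomial n 1)) =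
    Finsupp.single n (((-1) ^ n * (n.factorial : k)) • VirModule.of α Δ 1) := by
  simp [substNeg, Polynomial.lsum_apply, sum_monomial_index]

/-- Linear maps on `M_{(α, Δ)}` are determined by their values at the elements `∂ⁿ u`. -/
theorem VirModule.hom_ext {N : Type*} [AddCommGroup N] [Module k N] {α Δ : k}
    {F G : VirModule k α Δ →ₗ[k] N}
    (h : ∀ n, F (VirModule.of α Δ (monomial n 1)) = G (VirModule.of α Δ (monomial n 1))) :
    F = G := by
  have e : F ∘ₗ (VirModule.of α Δ).toLinearMap = G ∘ₗ (VirModule.of α Δ).toLinearMap :=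
    Polynomial.lhom_ext' fun n => LinearMap.ext_ring (h n)
  ext f
  obtain ⟨f, rfl⟩ := (VirModule.of α Δ).surjective f
  exact LinearMap.congr_fun e f

theorem substNeg_mder (α Δ : k) (f : VirModule k α Δ) :
    substNeg α Δ (partialM k (U3 k) _ f) = -mulVar k _ (substNeg α Δ f) := by
  have e : substNeg α Δ ∘ₗ partialM k (U3 k) (VirModule k α Δ) =
      -(mulVar k _ ∘ₗ substNeg α Δ) := by
    refine VirModule.hom_ext fun n => ?_
    rw [LinearMap.comp_apply, LinearMap.neg_apply, LinearMap.comp_apply, mder_of, X_mul_monomial,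
      substNeg_monomial, substNeg_monomial, mulVar_single, ← Finsupp.single_neg, smul_smul,
      ← neg_smul, Nat.factorial_succ]
    congr 2
    push_cast
    ring
  exact LinearMap.congr_fun e f

theorem evalNeg_substNeg [CharZero k] (α Δ : k) (f : VirModule k α Δ) :
    evalNeg (partialM k (U3 k) _) (substNeg α Δ f) = f := by
  have h : ∀ n, ((-partialM k (U3 k) (VirModule k α Δ)) ^ n) (VirModule.of α Δ 1) =
      (-1 : k) ^ n • VirModule.of α Δ (monomial n 1) := by
    intro n
    induction n with
    | zero => simp
    | succ n ih =>
      rw [pow_succ', Module.End.mul_apply, ih, LinearMap.neg_apply, map_smul, mder_of,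
        X_mul_monomial, pow_succ, mul_neg_one, neg_smul]
  have e : evalNeg (partialM k (U3 k) (VirModule k α Δ)) ∘ₗ substNeg α Δ = LinearMap.id := by
    refine VirModule.hom_ext fun n => ?_
    have hn : (n.factorial : k) ≠ 0 := by exact_mod_cast n.factorial_ne_zero
    have : (n.factorial : k)⁻¹ * ((-1) ^ n * (n.factorial : k)) * (-1) ^ n = 1 := by
      rw [mul_left_comm, inv_mul_cancel₀ hn, mul_one, ← mul_pow]
      simp
    rw [LinearMap.comp_apply, substNeg_monomial, evalNeg_single, map_smul, h, smul_smul,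
      smul_smul, this, one_smul, LinearMap.id_apply]
  exact LinearMap.congr_fun e f

/-- The coboundary of `f(∂) u` has reduction `f(0) ((1 - Δ) ∂ + α) u` at `v`: the reduction of
`a ↦ a ∘_λ ∂w = (∂ + λ) (a ∘_λ w)` vanishes, so only the constant term of `f` counts. -/
theorem evalCocycle_coboundary_of [CharZero k] (α Δ : k) (f : k[X]) :
    evalCocycle k (VirModule k α Δ)
      ⟨ofLinear (coboundary (VirModule.of α Δ f)), coboundary_mem_reducedCocycles _⟩ =
        VirModule.of α Δ (f.coeff 0 • (C (1 - Δ) * X + C α)) := by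
  set c := f.coeff 0
  have e : actVar k (VirModule k α Δ) (U3.v k) (VirModule.of α Δ (C c)) =
      Finsupp.single 0 (VirModule.of α Δ ((X + C α) * C c)) +
        Finsupp.single 1 (VirModule.of α Δ (C (Δ * c))) := by
    ext n
    rw [actVar_apply, act_v_of, virOp_apply, Finsupp.add_apply]
    rcases n with _ | _ | n
    · simp
    · simp
    · simp
  have hf : VirModule.of α Δ f =
      partialM k (U3 k) (VirModule k α Δ) (VirModule.of α Δ (divX f)) +
        VirModule.of α Δ (C c) := by
    rw [mder_of, ← map_add, X_mul_divX_add]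
  rw [evalCocycle_coboundary, hf, map_add, map_add, actVar_mder, evalNeg_addVar, zero_add, e,
    map_add, evalNeg_single, evalNeg_single, pow_one, LinearMap.neg_apply, mder_of]
  simp only [Nat.factorial_zero, Nat.factorial_one, Nat.cast_one, inv_one, one_smul, pow_zero,
    Module.End.one_apply, ← map_neg, ← map_add]
  congr 1
  simp only [smul_eq_C_mul, C_mul, C_sub, C_1]
  ring

theorem range_evalCocycle_virModule [CharZero k] (α Δ : k) :
    LinearMap.range (evalCocycle k (VirModule k α Δ)) = relVectors k (VirModule k α Δ) :=
  range_evalCocycle (substNeg α Δ) (substNeg_mder α Δ) (evalNeg_substNeg α Δ)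

/-- Unless `Δ = 1` and `α = 0`, the coboundary of `u` does not vanish and accounts for all
cocycles. -/
theorem reducedCocycles_le_of_ne [CharZero k] {α Δ : k} (hΔ : Δ ≠ 0) (h : ¬(Δ = 1 ∧ α = 0)) :
    reducedCocycles k (U3 k) (VirModule k α Δ) 1 ≤
      reducedCoboundaries k (U3 k) (VirModule k α Δ) 1 := by
  intro φ hφ
  obtain ⟨f, hfφ⟩ := (VirModule.of α Δ).surjective (evalCocycle k _ ⟨φ, hφ⟩)
  obtain ⟨x, y, hf, hxy⟩ := (of_mem_relVectors_iff hΔ f).1 (hfφ ▸ evalCocycle_mem ⟨φ, hφ⟩)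
  obtain ⟨c, hx, hy⟩ : ∃ c, x = c * (1 - Δ) ∧ y = c * α := by
    by_cases h1 : Δ = 1
    · have hα : α ≠ 0 := fun h0 => h ⟨h1, h0⟩
      subst h1
      rw [sub_self, zero_mul] at hxy
      refine ⟨y / α, ?_, (div_mul_cancel₀ y hα).symm⟩
      rw [sub_self, mul_zero]
      exact (mul_eq_zero.1 hxy).resolve_left hα
    · have h1' : 1 - Δ ≠ 0 := sub_ne_zero.2 (Ne.symm h1)
      refine ⟨x / (1 - Δ), (div_mul_cancel₀ x h1').symm, ?_⟩
      rw [div_mul_eq_mul_div, eq_div_iff h1', mul_comm x, hxy, mul_comm]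
  let ψ : reducedCocycles k (U3 k) (VirModule k α Δ) 1 :=
    ⟨ofLinear (coboundary (VirModule.of α Δ (C c))), coboundary_mem_reducedCocycles _⟩
  have hψ : evalCocycle k _ (⟨φ, hφ⟩ - ψ) = 0 := by
    rw [map_sub, sub_eq_zero, evalCocycle_coboundary_of, ← hfφ, hf, hx, hy, coeff_C_zero]
    congr 1
    simp only [smul_eq_C_mul, C_mul, C_sub, C_1]
    ring
  have hd : ψ.1 ∈ (cochains k (U3 k) (VirModule k α Δ) 0).map (d k _ _ 0) :=
    mem_map_d_zero_iff.2 ⟨_, rfl⟩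
  exact Submodule.mem_sup.2 ⟨ψ.1, hd, φ - ψ.1, (evalCocycle_eq_zero_iff _).1 hψ,
    add_sub_cancel _ _⟩

/-- If `Δ = 1` and `α = 0`, all coboundaries vanish in the reduced complex. -/
theorem reducedCoboundaries_submoduleOf [CharZero k] :
    (reducedCoboundaries k (U3 k) (VirModule k 0 1) 1).submoduleOf
      (reducedCocycles k (U3 k) (VirModule k 0 1) 1) =
        LinearMap.ker (evalCocycle k (VirModule k 0 1)) := by
  have h0 : ∀ u : VirModule k (0 : k) 1, evalCocycle k (VirModule k 0 1)
      ⟨ofLinear (coboundary u), coboundary_mem_reducedCocycles u⟩ = 0 := by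
    intro u
    obtain ⟨f, rfl⟩ := (VirModule.of 0 1).surjective u
    rw [evalCocycle_coboundary_of]
    simp
  have hd : (cochains k (U3 k) (VirModule k (0 : k) 1) 0).map (d k _ _ 0) ≤
      (cochains k (U3 k) (VirModule k (0 : k) 1) 1).map (partialOp k _ _ 1) := by
    intro φ hφ
    obtain ⟨u, rfl⟩ := mem_map_d_zero_iff.1 hφ
    exact (evalCocycle_eq_zero_iff _).1 (h0 u)
  ext φ
  rw [LinearMap.mem_ker, evalCocycle_eq_zero_iff, Submodule.submoduleOf, reducedCoboundaries,
    sup_eq_right.2 hd]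
  rfl

theorem relVectors_eq_degreeLT [CharZero k] :
    relVectors k (VirModule k (0 : k) 1) = (degreeLT k 2).map (VirModule.of 0 1).toLinearMap := by
  ext f
  obtain ⟨f, rfl⟩ := (VirModule.of 0 1).surjective f
  have hm : VirModule.of 0 1 f ∈ (degreeLT k 2).map (VirModule.of 0 1).toLinearMap ↔
      f ∈ degreeLT k 2 :=
    ⟨fun ⟨g, hg, e⟩ => (VirModule.of 0 1).injective e ▸ hg, fun h => ⟨f, h, rfl⟩⟩
  rw [of_mem_relVectors_iff one_ne_zero, hm, mem_degreeLT]
  constructor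
  · rintro ⟨x, y, rfl, -⟩
    exact lt_of_le_of_lt degree_linear_le (by norm_num)
  · intro h
    exact ⟨_, _, eq_X_add_C_of_degree_le_one (Order.le_of_lt_succ h), by simp⟩

end

end VirasoroU3

theorem mainTheorem2 {k : Type*} [Field k] [CharZero k] (α Δ : k) (hΔ : Δ ≠ 0) :
    ((Δ = 1 ∧ α = 0) →
      Module.rank k
        (ConformalCohomology.H k (VirasoroU3.U3 k) (VirasoroU3.VirModule k α Δ) 1) = 2) ∧
    (¬ (Δ = 1 ∧ α = 0) →
      Module.rank k
        (ConformalCohomology.H k (VirasoroU3.U3 k) (VirasoroU3.VirModule k α Δ) 1) = 0) := by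
  constructor
  · rintro ⟨rfl, rfl⟩
    rw [((Submodule.quotEquivOfEq _ _ VirasoroU3.reducedCoboundaries_submoduleOf).trans
        (LinearMap.quotKerEquivRange _)).rank_eq, VirasoroU3.range_evalCocycle_virModule,
      VirasoroU3.relVectors_eq_degreeLT]
    refine (((VirasoroU3.VirModule.of 0 1).submoduleMap (Polynomial.degreeLT k 2)).symm.trans
      (Polynomial.degreeLTEquiv k 2)).rank_eq.trans ?_
    simp
  · intro h
    have : Subsingleton (ConformalCohomology.H k (VirasoroU3.U3 k)
        (VirasoroU3.VirModule k α Δ) 1) :=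
      Submodule.Quotient.subsingleton_iff.2
        (Submodule.submoduleOf_eq_top.2 (VirasoroU3.reducedCocycles_le_of_ne hΔ h))
    exact rank_subsingleton' k _
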